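/- Let $\mathsf{RCA}_0^\omega$ be Kohlenbach's base theory of higher-order Reverse Mathematics: classical many-sorted predicate logic over all finite types, with equality $=_0$ of type $0$ as the only primitive predicate (equality at higher types is defined pointwise), constants $0$, $S$, the combinators $\Pi_{\sigma,\tau}$, $\Sigma_{\delta,\rho,\tau}$ and the type-$0$ recursor $R_0$, and as axioms the equality axioms for $=_0$, the successor axioms, the defining equations of the constants, the axioms of extensionality for all finite types, quantifier-free induction, and $\mathsf{QF}\text{-}\mathsf{AC}^{1,0}$: $\forall f^1\exists n^0 A(f,n)\to\exists F^2\forall f^1A(f,F(f))$ for quantifier-free $A$. Let $\mathsf{ACA}_0^\omega$ be $\mathsf{RCA}_0^\omega$ plus $$(\exists^2):\quad \exists\varphi^2\le_2 1\ \forall f^1\,\big[\exists n\,(f(n)=0)\leftrightarrow\varphi(f)=0\big].$$ Let $\mathsf{IND}_0$ be the statement: if $Y$ (mapping $f\in\mathbb N^{\mathbb N}$, $n\in\mathbb N$ to $Y(f,n)\in\mathbb N$) is such that for each $n$ there is at most one $f\in 2^{\mathbb N}$ with $Y(f,n)=0$, then for each $k$ there is a finite sequence $w$ of elements of $\mathbb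 N^{\mathbb N}$ such that for all $m\le k$, $$\exists i<|w|\,\big(w(i)\in 2^{\mathbb N}\wedge Y(w(i),m)=0\big)\leftrightarrow \exists f\in 2^{\mathbb N}\,\big(Y(f,m)=0\big).$$ Real numbers are represented by fast-converging Cauchy sequences of rationals, with the usual defined relations $=_{\mathbb R}$, $\le_{\mathbb R}$, $<_{\mathbb R}$. Functions on $[0,1]$ are functionals that respect $=_{\mathbb R}$ on $[0,1]$. Sets of reals are given by characteristic functions $\mathbb R\to\{0,1\}$. A set $P\subset[0,1]$ is \emph{perfect} if it is non-empty, closed, and has no isolated points. Let $\mathsf{B2}$ be the class of all $g:[0,1]\to\mathbb R$ for which there is a sequence of functions $g_n:[0,1]\to\mathbb R$ with $g(x)=\lim_{n\to\infty}g_n(x)$ for all $x\in[0,1]$, such that for all $n\in\mathbb N$ and all perfect $P\subset[0,1]$ the restriction $g_n{\upharpoonright}P$ has a point of continuity in $P$. Let $\mathsf{HBU}_{\mathsf{B2}}$ be the statement: for every $\Psi:[0,1]\to\mathbb R^+$ in $\mathsf{B2}$ there are $y_0,\dots,y_k\in[0,1]$ with $[0,1]\subset\bigcup_{i\le k}B(y_i,\Psi(y_i))$,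 where $B(y,r)$ is the open interval with centre $y$ and radius $r$. Let $\mathsf{NIN}$ be the statement that there is no injection from $[0,1]$ to $\mathbb N$. Then $\mathsf{ACA}_0^\omega+\mathsf{IND}_0$ proves $\mathsf{HBU}_{\mathsf{B2}}\to\mathsf{NIN}$. -/

import Mathlib

namespace HORM

/-! ## The language of higher-order arithmetic: finite types, terms, formulas -/

/-- Finite types: type `0`, and `σ → τ`. -/
inductive FType : Type
  | nat : FType
  | arr (σ τ : FType) : FType

infixr:60 " ⇒ " => FType.arr

/-- Type `0`. -/
abbrev T0 : FType := FType.nat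

/-- Type `1`, i.e. `0 → 0`. -/
abbrev T1 : FType := T0 ⇒ T0

/-- Type `2`, i.e. `1 → 0`. -/
abbrev T2 : FType := T1 ⇒ T0

/-- Bound variables (well-scoped de Bruijn indices) of type `σ` in a list of binders. -/
inductive Var : List FType → FType → Type
  | here {Γ : List FType} {σ : FType} : Var (σ :: Γ) σ
  | there {Γ : List FType} {σ τ : FType} (v : Var Γ τ) : Var (σ :: Γ) τ

/-- Terms, in the scope of the binders `Γ`.  The free variables are `fvar σ k` (`k : ℕ`), the
constants are zero, successor, the combinators `Π` and `Σ`, and the recursor `R₀`. -/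
inductive Tm (Γ : List FType) : FType → Type
  | bvar {σ : FType} (v : Var Γ σ) : Tm Γ σ
  | fvar (σ : FType) (k : ℕ) : Tm Γ σ
  | zero : Tm Γ T0
  | succ : Tm Γ (T0 ⇒ T0)
  | combPi (σ τ : FType) : Tm Γ (σ ⇒ τ ⇒ σ)
  | combSigma (δ ρ τ : FType) : Tm Γ ((δ ⇒ ρ ⇒ τ) ⇒ (δ ⇒ ρ) ⇒ δ ⇒ τ)
  | recursor : Tm Γ (T0 ⇒ T0 ⇒ (T0 ⇒ T0 ⇒ T0) ⇒ T0)
  | app {σ τ : FType} (f : Tm Γ (σ ⇒ τ)) (a : Tm Γ σ) : Tm Γ τ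

infixl:90 " ⬝ " => Tm.app

/-- Formulas, in the scope of the binders `Γ`.  The only primitive predicate is equality of
objects of type `0`; logic is classical, so that the other connectives are abbreviations. -/
inductive Fm : List FType → Type
  | bot {Γ : List FType} : Fm Γ
  | eq {Γ : List FType} (s t : Tm Γ T0) : Fm Γ
  | imp {Γ : List FType} (φ ψ : Fm Γ) : Fm Γ
  | all {Γ : List FType} {σ : FType} (φ : Fm (σ :: Γ)) : Fm Γ

/-- Simultaneous substitution for the bound variables (terms contain no binders). -/
def Tm.subst {Γ Δ : List FType} (s : ∀ σ, Var Γ σ → Tm Δ σ) : {τ : FType} → Tm Γ τ → Tm Δ τ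
  | _, .bvar v => s _ v
  | _, .fvar σ k => .fvar σ k
  | _, .zero => .zero
  | _, .succ => .succ
  | _, .combPi σ τ => .combPi σ τ
  | _, .combSigma δ ρ τ => .combSigma δ ρ τ
  | _, .recursor => .recursor
  | _, .app f a => .app (f.subst s) (a.subst s)

/-- Weakening by one binder. -/
def Tm.wk {Γ : List FType} {σ τ : FType} (t : Tm Γ τ) : Tm (σ :: Γ) τ :=
  t.subst fun _ v => .bvar (.there v)

/-- A substitution, pushed under one binder. -/
def liftSubst {Γ Δ : List FType} (s : ∀ σ, Var Γ σ → Tm Δ σ) (ρ : FType) :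
    ∀ σ, Var (ρ :: Γ) σ → Tm (ρ :: Δ) σ
  | _, .here => .bvar .here
  | _, .there v => (s _ v).wk

def Fm.subst {Γ Δ : List FType} (s : ∀ σ, Var Γ σ → Tm Δ σ) : Fm Γ → Fm Δ
  | .bot => .bot
  | .eq t u => .eq (t.subst s) (u.subst s)
  | .imp φ ψ => .imp (φ.subst s) (ψ.subst s)
  | .all (σ := σ) φ => .all (φ.subst (liftSubst s σ))

/-- Extend a substitution by a term for the innermost variable. -/
def consSubst {Γ Δ : List FType} {ρ : FType} (t : Tm Δ ρ) (s : ∀ σ, Var Γ σ → Tm Δ σ) :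
    ∀ σ, Var (ρ :: Γ) σ → Tm Δ σ
  | _, .here => t
  | _, .there v => s _ v

/-- `φ(t)`, the instance of `φ` at the term `t` for the innermost variable. -/
def Fm.inst {Γ : List FType} {σ : FType} (φ : Fm (σ :: Γ)) (t : Tm Γ σ) : Fm Γ :=
  φ.subst (consSubst t fun _ v => .bvar v)

/-- The free variable `fvar σ k` occurs in a term. -/
def Tm.Occurs {Γ : List FType} (σ : FType) (k : ℕ) : {τ : FType} → Tm Γ τ → Prop
  | _, .fvar σ' k' => σ' = σ ∧ k' = k
  | _, .app f a => f.Occurs σ k ∨ a.Occurs σ k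
  | _, _ => False

/-- The free variable `fvar σ k` occurs in a formula. -/
def Fm.Occurs (σ : FType) (k : ℕ) : {Γ : List FType} → Fm Γ → Prop
  | _, .bot => False
  | _, .eq s t => s.Occurs σ k ∨ t.Occurs σ k
  | _, .imp φ ψ => φ.Occurs σ k ∨ ψ.Occurs σ k
  | _, .all φ => φ.Occurs σ k

/-- Quantifier-free formulas. -/
def Fm.QF : {Γ : List FType} → Fm Γ → Prop
  | _, .bot => True
  | _, .eq _ _ => True
  | _, .imp φ ψ => φ.QF ∧ ψ.QF
  | _, .all _ => False

section Connectives

variable {Γ : List FType}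

def Fm.neg (φ : Fm Γ) : Fm Γ := .imp φ .bot

def Fm.and (φ ψ : Fm Γ) : Fm Γ := .neg (.imp φ (.neg ψ))

def Fm.iff (φ ψ : Fm Γ) : Fm Γ := .and (.imp φ ψ) (.imp ψ φ)

/-- `∀ x^σ, F x`; terms that come from outside the quantifier are weakened with `wk`. -/
def allQ (σ : FType) (F : Tm (σ :: Γ) σ → Fm (σ :: Γ)) : Fm Γ := .all (F (.bvar .here))

/-- `∃ x^σ, F x`. -/
def exQ (σ : FType) (F : Tm (σ :: Γ) σ → Fm (σ :: Γ)) : Fm Γ :=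
  .neg (allQ σ fun x => .neg (F x))

end Connectives

infixr:40 " ⟶ " => Fm.imp
infixr:50 " ⋀ " => Fm.and
infix:35 " ⟷ " => Fm.iff
infix:55 " ≐ " => Fm.eq

/-! ## Derivability: natural deduction for classical many-sorted predicate logic -/

/-- `Proves T Δ φ`: the formula `φ` is derivable from the finitely many hypotheses `Δ` and the
non-logical axioms `T` (whose free variables are understood as universally quantified). -/
inductive Proves (T : Set (Fm [])) : List (Fm []) → Fm [] → Prop
  | ax {Δ : List (Fm [])} {φ : Fm []} (h : φ ∈ T) : Proves T Δ φ
  | hyp {Δ : List (Fm [])} {φ : Fm []} (h : φ ∈ Δ) : Proves T Δ φ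
  | weaken {Δ Δ' : List (Fm [])} {φ : Fm []} (h : Δ ⊆ Δ') (d : Proves T Δ φ) : Proves T Δ' φ
  | impI {Δ : List (Fm [])} {φ ψ : Fm []} (d : Proves T (φ :: Δ) ψ) : Proves T Δ (φ ⟶ ψ)
  | impE {Δ : List (Fm [])} {φ ψ : Fm []} (d : Proves T Δ (φ ⟶ ψ)) (e : Proves T Δ φ) :
      Proves T Δ ψ
  | raa {Δ : List (Fm [])} {φ : Fm []} (d : Proves T (φ.neg :: Δ) .bot) : Proves T Δ φ
  | allI {Δ : List (Fm [])} {σ : FType} {φ : Fm [σ]} (k : ℕ) (hφ : ¬ φ.Occurs σ k)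
      (hΔ : ∀ ψ ∈ Δ, ¬ ψ.Occurs σ k) (d : Proves T Δ (φ.inst (.fvar σ k))) :
      Proves T Δ (.all φ)
  | allE {Δ : List (Fm [])} {σ : FType} {φ : Fm [σ]} (d : Proves T Δ (.all φ)) (t : Tm [] σ) :
      Proves T Δ (φ.inst t)

/-! ## The base theory -/

/-- Equality at type `σ`: `s x₁ … xₙ = t x₁ … xₙ` at type `0` for all `x₁, …, xₙ`. -/
def eqT : (σ : FType) → {Γ : List FType} → Tm Γ σ → Tm Γ σ → Fm Γ
  | .nat, _, s, t => s ≐ t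
  | .arr σ τ, _, s, t => allQ σ fun x => eqT τ (s.wk ⬝ x) (t.wk ⬝ x)

/-- The axioms of Kohlenbach's base theory `RCA₀^ω`, that is `E-PRA^ω + QF-AC^{1,0}`.  In the two
schemes the parameters are the free variables of the formula `A`. -/
inductive RCA0omega : Fm [] → Prop
  | eq_refl : RCA0omega (allQ T0 fun x => x ≐ x)
  | eq_symm : RCA0omega (allQ T0 fun x => allQ T0 fun y => x.wk ≐ y ⟶ y ≐ x.wk)
  | eq_trans : RCA0omega (allQ T0 fun x => allQ T0 fun y => allQ T0 fun z =>
      x.wk.wk ≐ y.wk ⟶ y.wk ≐ z ⟶ x.wk.wk ≐ z)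
  | succ_ne_zero : RCA0omega (allQ T0 fun x => Fm.neg (.succ ⬝ x ≐ .zero))
  | succ_inj : RCA0omega (allQ T0 fun x => allQ T0 fun y =>
      .succ ⬝ x.wk ≐ .succ ⬝ y ⟶ x.wk ≐ y)
  | combPi (σ τ : FType) : RCA0omega (allQ σ fun x => allQ τ fun y =>
      eqT σ (.combPi σ τ ⬝ x.wk ⬝ y) x.wk)
  | combSigma (δ ρ τ : FType) : RCA0omega (allQ (δ ⇒ ρ ⇒ τ) fun x => allQ (δ ⇒ ρ) fun y =>
      allQ δ fun z => eqT τ (.combSigma δ ρ τ ⬝ x.wk.wk ⬝ y.wk ⬝ z)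
        (x.wk.wk ⬝ z ⬝ (y.wk ⬝ z)))
  | rec_zero : RCA0omega (allQ T0 fun y => allQ (T0 ⇒ T0 ⇒ T0) fun z =>
      .recursor ⬝ .zero ⬝ y.wk ⬝ z ≐ y.wk)
  | rec_succ : RCA0omega (allQ T0 fun x => allQ T0 fun y => allQ (T0 ⇒ T0 ⇒ T0) fun z =>
      .recursor ⬝ (.succ ⬝ x.wk.wk) ⬝ y.wk ⬝ z ≐
        z ⬝ (.recursor ⬝ x.wk.wk ⬝ y.wk ⬝ z) ⬝ x.wk.wk)
  /-- Extensionality `E_{σ,τ}`. -/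
  | ext (σ τ : FType) : RCA0omega (allQ (σ ⇒ τ) fun z => allQ σ fun x => allQ σ fun y =>
      eqT σ x.wk y ⟶ eqT τ (z.wk.wk ⬝ x.wk) (z.wk.wk ⬝ y))
  /-- Quantifier-free induction. -/
  | qfInd (A : Fm [T0]) (hA : A.QF) : RCA0omega
      (A.inst .zero ⟶
        .all (A ⟶ A.subst (consSubst (.succ ⬝ .bvar .here) fun _ v => .bvar (.there v))) ⟶
        .all A)
  /-- `QF-AC^{1,0}`: if `∀ f^1 ∃ n^0 A(f,n)` then `∃ F^2 ∀ f^1 A(f,F(f))`. -/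
  | qfAC (A : Fm [T0, T1]) (hA : A.QF) : RCA0omega
      ((allQ T1 fun _ => .neg (.all A.neg)) ⟶
        exQ T2 fun F => allQ T1 fun f =>
          A.subst (consSubst (F.wk ⬝ f) (consSubst f fun _ v => .bvar (.there (.there v)))))

/-! ## Primitive recursive arithmetic on terms -/

section Arithmetic

variable {Γ : List FType}

/-- Abstraction of the innermost variable, `λ x, t`, defined through the combinators. -/
def Tm.lam {σ : FType} : {τ : FType} → Tm (σ :: Γ) τ → Tm Γ (σ ⇒ τ)
  | _, .bvar .here => .combSigma σ (σ ⇒ σ) σ ⬝ .combPi σ (σ ⇒ σ) ⬝ .combPi σ σ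
  | _, .bvar (.there v) => .combPi _ σ ⬝ .bvar v
  | _, .fvar τ k => .combPi _ σ ⬝ .fvar τ k
  | _, .zero => .combPi _ σ ⬝ .zero
  | _, .succ => .combPi _ σ ⬝ .succ
  | _, .combPi ρ τ => .combPi _ σ ⬝ .combPi ρ τ
  | _, .combSigma δ ρ τ => .combPi _ σ ⬝ .combSigma δ ρ τ
  | _, .recursor => .combPi _ σ ⬝ .recursor
  | _, .app f a => .combSigma _ _ _ ⬝ f.lam ⬝ a.lam

/-- `λ x^σ, F x`. -/
def lamQ (σ : FType) {τ : FType} (F : Tm (σ :: Γ) σ → Tm (σ :: Γ) τ) : Tm Γ (σ ⇒ τ) :=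
  (F (.bvar .here)).lam

/-- Primitive recursion: `g 0 = base`, `g (v + 1) = step (g v) v`, evaluated at `n`. -/
def natRec (n base : Tm Γ T0)
    (step : Tm (T0 :: T0 :: Γ) T0 → Tm (T0 :: T0 :: Γ) T0 → Tm (T0 :: T0 :: Γ) T0) : Tm Γ T0 :=
  .recursor ⬝ n ⬝ base ⬝ lamQ T0 fun u => lamQ T0 fun v => step u.wk v

def sc (t : Tm Γ T0) : Tm Γ T0 := .succ ⬝ t

def one : Tm Γ T0 := sc .zero

def two : Tm Γ T0 := sc one

def add (s t : Tm Γ T0) : Tm Γ T0 := natRec t s fun u _ => sc u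

def mul (s t : Tm Γ T0) : Tm Γ T0 := natRec t .zero fun u _ => add u s.wk.wk

def pow2 (t : Tm Γ T0) : Tm Γ T0 := natRec t one fun u _ => add u u

def pred (t : Tm Γ T0) : Tm Γ T0 := natRec t .zero fun _ v => v

/-- Truncated subtraction. -/
def monus (s t : Tm Γ T0) : Tm Γ T0 := natRec t s fun u _ => pred u

/-- `1` if `s = t`, and `0` otherwise. -/
def eqInd (s t : Tm Γ T0) : Tm Γ T0 := monus one (add (monus s t) (monus t s))

/-- Triangular numbers `0 + 1 + ⋯ + t`. -/
def tri (t : Tm Γ T0) : Tm Γ T0 := natRec t .zero fun u v => add u (sc v)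

/-- The largest `s` with `tri s ≤ t`. -/
def diag (t : Tm Γ T0) : Tm Γ T0 := natRec t .zero fun u v => add u (eqInd (tri (sc u)) (sc v))

/-- Cantor's pairing bijection and its two inverse projections. -/
def pair (s t : Tm Γ T0) : Tm Γ T0 := add (tri (add s t)) s

def fst (p : Tm Γ T0) : Tm Γ T0 := monus p (tri (diag p))

def snd (p : Tm Γ T0) : Tm Γ T0 := monus (diag p) (fst p)

def leN (s t : Tm Γ T0) : Fm Γ := monus s t ≐ .zero

def ltN (s t : Tm Γ T0) : Fm Γ := leN (sc s) t

/-! Rational numbers: the natural number `⟨a, ⟨b, c⟩⟩` codes `(a - b) / (c + 1)`, so that every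
natural number is a code. -/

def mkQ (a b c : Tm Γ T0) : Tm Γ T0 := pair a (pair b c)

/-- Positive part, negative part and denominator of a code. -/
def qPos (q : Tm Γ T0) : Tm Γ T0 := fst q

def qNeg (q : Tm Γ T0) : Tm Γ T0 := fst (snd q)

def qDen (q : Tm Γ T0) : Tm Γ T0 := sc (snd (snd q))

def qLe (p q : Tm Γ T0) : Fm Γ :=
  leN (add (mul (qPos p) (qDen q)) (mul (qNeg q) (qDen p)))
    (add (mul (qPos q) (qDen p)) (mul (qNeg p) (qDen q)))

def qAdd (p q : Tm Γ T0) : Tm Γ T0 :=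
  mkQ (add (mul (qPos p) (qDen q)) (mul (qPos q) (qDen p)))
    (add (mul (qNeg p) (qDen q)) (mul (qNeg q) (qDen p)))
    (pred (mul (qDen p) (qDen q)))

def qSub (p q : Tm Γ T0) : Tm Γ T0 :=
  mkQ (add (mul (qPos p) (qDen q)) (mul (qNeg q) (qDen p)))
    (add (mul (qNeg p) (qDen q)) (mul (qPos q) (qDen p)))
    (pred (mul (qDen p) (qDen q)))

def qAbs (p : Tm Γ T0) : Tm Γ T0 :=
  mkQ (add (monus (qPos p) (qNeg p)) (monus (qNeg p) (qPos p))) .zero (pred (qDen p))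

/-- The rational number `m / 2^k`. -/
def qDyadic (m k : Tm Γ T0) : Tm Γ T0 := mkQ m .zero (pred (pow2 k))

/-! ## Real numbers: fast-converging Cauchy sequences of rationals -/

/-- `x ∈ ℝ`: `|x(k) - x(k+i)| ≤ 2^{-k}` for all `k`, `i`. -/
def isReal (x : Tm Γ T1) : Fm Γ :=
  allQ T0 fun k => allQ T0 fun i =>
    qLe (qAbs (qSub (x.wk.wk ⬝ k.wk) (x.wk.wk ⬝ add k.wk i))) (qDyadic one k.wk)

/-- `x = y` in `ℝ`: `|x(k) - y(k)| ≤ 2^{-k+1}` for all `k`. -/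
def rEq (x y : Tm Γ T1) : Fm Γ :=
  allQ T0 fun k => qLe (qAbs (qSub (x.wk ⬝ k) (y.wk ⬝ k))) (qDyadic two k)

/-- `x ≤ y` in `ℝ`: `x(k) ≤ y(k) + 2^{-k+1}` for all `k`. -/
def rLe (x y : Tm Γ T1) : Fm Γ :=
  allQ T0 fun k => qLe (x.wk ⬝ k) (qAdd (y.wk ⬝ k) (qDyadic two k))

def rLt (x y : Tm Γ T1) : Fm Γ := (rLe y x).neg

/-- A rational number as a real number: the constant sequence. -/
def ofQ (q : Tm Γ T0) : Tm Γ T1 := lamQ T0 fun _ => q.wk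

def rZero : Tm Γ T1 := ofQ (mkQ .zero .zero .zero)

def rOne : Tm Γ T1 := ofQ (mkQ one .zero .zero)

/-- `x - y`, as the sequence `x(k+1) - y(k+1)`. -/
def rSub (x y : Tm Γ T1) : Tm Γ T1 := lamQ T0 fun k => qSub (x.wk ⬝ sc k) (y.wk ⬝ sc k)

def rAbs (x : Tm Γ T1) : Tm Γ T1 := lamQ T0 fun k => qAbs (x.wk ⬝ k)

/-- `|x - y| < r` in `ℝ`. -/
def distLt (x y r : Tm Γ T1) : Fm Γ := rLt (rAbs (rSub x y)) r

/-- `|x - y| < 2^{-k}` in `ℝ`. -/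
def near (x y : Tm Γ T1) (k : Tm Γ T0) : Fm Γ := distLt x y (ofQ (qDyadic one k))

/-- `x ∈ [0,1]`. -/
def inUnit (x : Tm Γ T1) : Fm Γ := isReal x ⋀ rLe rZero x ⋀ rLe x rOne

/-! ## Functions on the unit interval, sets of reals -/

/-- `Y : [0,1] → ℕ`: equal reals have equal values. -/
def isFunUnitNat (Y : Tm Γ T2) : Fm Γ :=
  allQ T1 fun x => allQ T1 fun y => inUnit x.wk ⟶ inUnit y ⟶ rEq x.wk y ⟶
    Y.wk.wk ⬝ x.wk ≐ Y.wk.wk ⬝ y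

/-- `g : [0,1] → ℝ`: the values are reals, and equal reals have equal values. -/
def isFunUnitReal (g : Tm Γ (T1 ⇒ T1)) : Fm Γ :=
  (allQ T1 fun x => inUnit x ⟶ isReal (g.wk ⬝ x)) ⋀
  (allQ T1 fun x => allQ T1 fun y => inUnit x.wk ⟶ inUnit y ⟶ rEq x.wk y ⟶
    rEq (g.wk.wk ⬝ x.wk) (g.wk.wk ⬝ y))

/-- `P : ℝ → {0,1}`, a subset of `ℝ`. -/
def isSet (P : Tm Γ T2) : Fm Γ :=
  (allQ T1 fun x => isReal x ⟶ leN (P.wk ⬝ x) one) ⋀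
  (allQ T1 fun x => allQ T1 fun y => isReal x.wk ⟶ isReal y ⟶ rEq x.wk y ⟶
    P.wk.wk ⬝ x.wk ≐ P.wk.wk ⬝ y)

/-- `x ∈ P` for a real `x`. -/
def mem (x : Tm Γ T1) (P : Tm Γ T2) : Fm Γ := isReal x ⋀ P ⬝ x ≐ one

/-- The set `P` is a perfect subset of `[0,1]`: it is non-empty, closed (each real outside of `P`
has a neighbourhood disjoint from `P`), and without isolated points. -/
def isPerfectInUnit (P : Tm Γ T2) : Fm Γ :=
  isSet P ⋀
  (allQ T1 fun x => mem x P.wk ⟶ inUnit x) ⋀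
  (exQ T1 fun x => mem x P.wk) ⋀
  (allQ T1 fun x => isReal x ⟶ (mem x P.wk).neg ⟶
    exQ T0 fun k => allQ T1 fun y => mem y P.wk.wk.wk ⟶ (near x.wk.wk y k.wk).neg) ⋀
  (allQ T1 fun x => mem x P.wk ⟶ allQ T0 fun k =>
    exQ T1 fun y => mem y P.wk.wk.wk ⋀ (rEq x.wk.wk y).neg ⋀ near x.wk.wk y k.wk)

/-- The restriction of `g` to `P` is continuous at `x`. -/
def continuousOnAt (g : Tm Γ (T1 ⇒ T1)) (P : Tm Γ T2) (x : Tm Γ T1) : Fm Γ :=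
  allQ T0 fun k => exQ T0 fun m => allQ T1 fun y =>
    mem y P.wk.wk.wk ⟶ near x.wk.wk.wk y m.wk ⟶
      near (g.wk.wk.wk ⬝ x.wk.wk.wk) (g.wk.wk.wk ⬝ y) k.wk.wk

/-- The function `g` is the limit of `G 0, G 1, G 2, …` on `[0,1]`. -/
def isLimit (G : Tm Γ (T0 ⇒ T1 ⇒ T1)) (g : Tm Γ (T1 ⇒ T1)) : Fm Γ :=
  allQ T1 fun x => inUnit x ⟶ allQ T0 fun k => exQ T0 fun N => allQ T0 fun n =>
    leN N.wk n ⟶ near (G.wk.wk.wk.wk ⬝ n ⬝ x.wk.wk.wk) (g.wk.wk.wk.wk ⬝ x.wk.wk.wk) k.wk.wk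

/-- The class `B2`: `g : [0,1] → ℝ` is the pointwise limit of a sequence of functions on `[0,1]`
each of which has, when restricted to any perfect `P ⊆ [0,1]`, a point of continuity on `P`. -/
def isB2 (g : Tm Γ (T1 ⇒ T1)) : Fm Γ :=
  isFunUnitReal g ⋀
  exQ (T0 ⇒ T1 ⇒ T1) fun G =>
    (allQ T0 fun n => isFunUnitReal (G.wk ⬝ n)) ⋀
    isLimit G g.wk ⋀
    (allQ T0 fun n => allQ T2 fun P => isPerfectInUnit P ⟶
      exQ T1 fun x => mem x P.wk ⋀ continuousOnAt (G.wk.wk.wk ⬝ n.wk.wk) P.wk x)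

end Arithmetic

/-! ## The principles -/

/-- `∃ φ^2 ≤ 1, ∀ f^1, (∃ n, f(n) = 0) ↔ φ(f) = 0`. -/
def existsTwo : Fm [] :=
  exQ T2 fun φ =>
    (allQ T1 fun f => leN (φ.wk ⬝ f) one) ⋀
    (allQ T1 fun f => (exQ T0 fun n => f.wk ⬝ n ≐ .zero) ⟷ φ.wk ⬝ f ≐ .zero)

/-- `f ∈ 2^ℕ`. -/
def inCantor {Γ : List FType} (f : Tm Γ T1) : Fm Γ := allQ T0 fun n => leN (f.wk ⬝ n) one

/-- If for each `n` there is at most one `f ∈ 2^ℕ` with `Y(f,n) = 0`, then for each `k` there is a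
finite sequence `w` (of length `l`) of objects of type `1` such that for all `m ≤ k`:
`(∃ i < l) (w(i) ∈ 2^ℕ ∧ Y(w(i),m) = 0) ↔ (∃ f ∈ 2^ℕ) Y(f,m) = 0`. -/
def indZero : Fm [] :=
  allQ (T1 ⇒ T0 ⇒ T0) fun Y =>
    (allQ T0 fun n => allQ T1 fun f => allQ T1 fun g =>
      inCantor f.wk ⟶ inCantor g ⟶
      Y.wk.wk.wk ⬝ f.wk ⬝ n.wk.wk ≐ .zero ⟶ Y.wk.wk.wk ⬝ g ⬝ n.wk.wk ≐ .zero ⟶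
      eqT T1 f.wk g) ⟶
    allQ T0 fun k => exQ T0 fun l => exQ (T0 ⇒ T1) fun w => allQ T0 fun m =>
      leN m k.wk.wk.wk ⟶
      ((exQ T0 fun i => ltN i l.wk.wk.wk ⋀ inCantor (w.wk.wk ⬝ i) ⋀
          Y.wk.wk.wk.wk.wk ⬝ (w.wk.wk ⬝ i) ⬝ m.wk ≐ .zero) ⟷
        exQ T1 fun f => inCantor f ⋀ Y.wk.wk.wk.wk.wk ⬝ f ⬝ m.wk ≐ .zero)

/-- There is no injection from `[0,1]` to `ℕ`. -/
def NIN : Fm [] :=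
  Fm.neg <| exQ T2 fun Y =>
    isFunUnitNat Y ⋀
    (allQ T1 fun x => allQ T1 fun y => inUnit x.wk ⟶ inUnit y ⟶
      Y.wk.wk ⬝ x.wk ≐ Y.wk.wk ⬝ y ⟶ rEq x.wk y)

/-- For each `Ψ : [0,1] → ℝ⁺` in `B2` there are `y₀, …, y_k ∈ [0,1]` such that the open intervals
`B(y_i, Ψ(y_i))`, `i ≤ k`, cover `[0,1]`. -/
def HBUB2 : Fm [] :=
  allQ (T1 ⇒ T1) fun Ψ =>
    isB2 Ψ ⟶
    (allQ T1 fun x => inUnit x ⟶ rLt rZero (Ψ.wk ⬝ x)) ⟶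
    exQ T0 fun k => exQ (T0 ⇒ T1) fun y =>
      (allQ T0 fun i => leN i k.wk.wk ⟶ inUnit (y.wk ⬝ i)) ⋀
      (allQ T1 fun x => inUnit x ⟶ exQ T0 fun i =>
        leN i k.wk.wk.wk ⋀
        distLt x.wk (y.wk.wk ⬝ i) (Ψ.wk.wk.wk.wk ⬝ (y.wk.wk ⬝ i)))

/-- `ACA₀^ω + IND₀`, where `ACA₀^ω` is `RCA₀^ω + (∃²)`. -/
def ACA0omegaIND0 : Set (Fm []) :=
  {φ | RCA0omega φ ∨ φ = existsTwo ∨ φ = indZero}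

end HORM

namespace HORM

/-! ## Countability of the language -/

/-! Derivability is reduced to truth in models: a formula true in every extensional model of the
axioms is derivable (`proves_of_sat`). This is Henkin's argument; the countermodel consists of terms
without bound variables modulo provable equality. It remains to reason inside an arbitrary model.
Its numbers may be nonstandard, so "finite" means bounded by a number of the model, and induction,
recursion and abstraction are available only for definable predicates and functions. With `∃²` the
definable predicates are closed under number quantifiers.

Suppose that Y is an injection from [0,1] to the numbers, and put Ψ(x) = 4^{-Y(x)-1}. This gauge
lies in `B2` (`sat_isB2_gauge`): it is the pointwise limit of the truncations 4^{-min(Y(x),n)-1}. By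
`IND₀` the points with Y(x) ≤ n form a finite list (`exists_list`), so a set without isolated points
has a member near which all members satisfy Y ≥ n (`exists_avoiding`), and there the n-th truncation
is constant. Since `IND₀` concerns Cantor space, a real is coded by the set of its rational
approximations, which depends only on the real and not on its representation (`encode_congr`).

On the other hand, no finite family B(y_i, Ψ(y_i)) covers [0,1] (`not_distLt_avoid`). Build nested
intervals of length 4^{-m}. By injectivity at most one real among the y_i has Y-value m. If it lies
in the left half of the m-th interval, pass to the last quarter, otherwise to the first. The common
point then has distance at least 4^{-m-1} = Ψ(y_i) from it. Hence the covering principle fails for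
Ψ, and Y cannot exist. -/

def FType.code : FType → ℕ
  | .nat => 0
  | .arr σ τ => Nat.pair σ.code τ.code + 1

theorem FType.code_injective : Function.Injective FType.code := by
  intro σ
  induction σ with
  | nat => intro τ h; cases τ <;> simp_all [FType.code]
  | arr σ₁ σ₂ ih₁ ih₂ =>
    intro τ h
    cases τ with
    | nat => simp [FType.code] at h
    | arr τ₁ τ₂ =>
      simp only [FType.code, Nat.add_right_cancel_iff, Nat.pair_eq_pair] at h
      rw [ih₁ h.1, ih₂ h.2]

def Var.code : {Γ : List FType} → {σ : FType} → Var Γ σ → ℕ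
  | _, _, .here => 0
  | _, _, .there v => v.code + 1

theorem Var.code_inj {Γ : List FType} {σ τ : FType} (v : Var Γ σ) (w : Var Γ τ)
    (h : v.code = w.code) : σ = τ ∧ HEq v w := by
  induction v with
  | here => cases w <;> simp_all [Var.code]
  | there v ih =>
    cases w with
    | here => simp [Var.code] at h
    | there w =>
      obtain ⟨rfl, h'⟩ := ih w (by simpa [Var.code] using h)
      simp [eq_of_heq h']

def Tm.code {Γ : List FType} : {τ : FType} → Tm Γ τ → ℕ
  | _, .bvar v => Nat.pair 0 v.code
  | _, .fvar σ k => Nat.pair 1 (Nat.pair σ.code k)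
  | _, .zero => Nat.pair 2 0
  | _, .succ => Nat.pair 3 0
  | _, .combPi σ τ => Nat.pair 4 (Nat.pair σ.code τ.code)
  | _, .combSigma δ ρ τ => Nat.pair 5 (Nat.pair δ.code (Nat.pair ρ.code τ.code))
  | _, .recursor => Nat.pair 6 0
  | _, .app f a => Nat.pair 7 (Nat.pair f.code a.code)

/-- An application hides the type of its argument, so the induction has to compare terms of
different types; hence the conclusion with `HEq`. -/
theorem Tm.code_inj {Γ : List FType} {σ τ : FType} (s : Tm Γ σ) (t : Tm Γ τ)
    (h : s.code = t.code) : σ = τ ∧ HEq s t := by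
  induction s generalizing τ with
  | bvar v =>
    cases t <;> simp only [Tm.code, Nat.pair_eq_pair] at h <;> try simp at h
    obtain ⟨rfl, h'⟩ := Var.code_inj _ _ h
    simp [eq_of_heq h']
  | fvar σ k =>
    cases t <;> simp only [Tm.code, Nat.pair_eq_pair] at h <;> try simp at h
    obtain ⟨h, rfl⟩ := h
    obtain rfl := FType.code_injective h
    simp
  | zero => cases t <;> simp_all [Tm.code]
  | succ => cases t <;> simp_all [Tm.code]
  | combPi σ τ =>
    cases t <;> simp only [Tm.code, Nat.pair_eq_pair] at h <;> try simp at h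
    obtain ⟨h, h'⟩ := h
    obtain rfl := FType.code_injective h
    obtain rfl := FType.code_injective h'
    simp
  | combSigma δ ρ τ =>
    cases t <;> simp only [Tm.code, Nat.pair_eq_pair] at h <;> try simp at h
    obtain ⟨h, h', h''⟩ := h
    obtain rfl := FType.code_injective h
    obtain rfl := FType.code_injective h'
    obtain rfl := FType.code_injective h''
    simp
  | recursor => cases t <;> simp_all [Tm.code]
  | app f a ihf iha =>
    cases t <;> simp only [Tm.code, Nat.pair_eq_pair] at h <;> try simp at h
    obtain ⟨e, h₁⟩ := ihf _ h.1
    obtain ⟨-, h₂⟩ := iha _ h.2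
    injection e with e₁ e₂
    subst e₁ e₂
    simp [eq_of_heq h₁, eq_of_heq h₂]

def Fm.code : {Γ : List FType} → Fm Γ → ℕ
  | _, .bot => Nat.pair 0 0
  | _, .eq s t => Nat.pair 1 (Nat.pair s.code t.code)
  | _, .imp φ ψ => Nat.pair 2 (Nat.pair φ.code ψ.code)
  | _, .all (σ := σ) φ => Nat.pair 3 (Nat.pair σ.code φ.code)

theorem Fm.code_injective {Γ : List FType} : Function.Injective (Fm.code (Γ := Γ)) := by
  intro φ
  induction φ with
  | bot => intro ψ h; cases ψ <;> simp_all [Fm.code]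
  | eq s t =>
    intro ψ h
    cases ψ <;> simp only [Fm.code, Nat.pair_eq_pair] at h <;> try simp at h
    rw [eq_of_heq (Tm.code_inj _ _ h.1).2, eq_of_heq (Tm.code_inj _ _ h.2).2]
  | imp φ₁ φ₂ ih₁ ih₂ =>
    intro ψ h
    cases ψ <;> simp only [Fm.code, Nat.pair_eq_pair] at h <;> try simp at h
    rw [ih₁ h.1, ih₂ h.2]
  | all φ ih =>
    intro ψ h
    cases ψ <;> simp only [Fm.code, Nat.pair_eq_pair] at h <;> try simp at h
    obtain ⟨h, h'⟩ := h
    obtain rfl := FType.code_injective h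
    rw [ih h']

instance {Γ : List FType} : Countable (Fm Γ) := Fm.code_injective.countable

/-! ## Substitution -/

section Substitution

variable {Γ Δ Θ : List FType}

theorem Tm.subst_subst (s : ∀ σ, Var Γ σ → Tm Δ σ) (s' : ∀ σ, Var Δ σ → Tm Θ σ) {τ : FType}
    (t : Tm Γ τ) : (t.subst s).subst s' = t.subst fun σ v => (s σ v).subst s' := by
  induction t <;> simp_all [Tm.subst]

theorem Tm.subst_bvar {τ : FType} (t : Tm Γ τ) : t.subst (fun _ v => .bvar v) = t := by
  induction t <;> simp_all [Tm.subst]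

@[simp] theorem Tm.wk_subst_consSubst {σ τ : FType} (t : Tm Γ τ) (u : Tm Δ σ)
    (s : ∀ σ, Var Γ σ → Tm Δ σ) : t.wk.subst (consSubst u s) = t.subst s := by
  simp [Tm.wk, Tm.subst_subst, Tm.subst, consSubst]

@[simp] theorem Tm.wk_subst_liftSubst {σ τ : FType} (t : Tm Γ τ)
    (s : ∀ σ, Var Γ σ → Tm Δ σ) : t.wk.subst (liftSubst s σ) = (t.subst s).wk := by
  simp [Tm.wk, Tm.subst_subst, Tm.subst, liftSubst]

theorem Fm.subst_subst (φ : Fm Γ) : ∀ {Δ Θ : List FType} (s : ∀ σ, Var Γ σ → Tm Δ σ)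
    (s' : ∀ σ, Var Δ σ → Tm Θ σ),
    (φ.subst s).subst s' = φ.subst fun σ v => (s σ v).subst s' := by
  induction φ with
  | bot => intros; rfl
  | eq => intros; simp [Fm.subst, Tm.subst_subst]
  | imp φ ψ ih ih' => intros; simp [Fm.subst, ih, ih']
  | all φ ih =>
    intro Δ Θ s s'
    simp only [Fm.subst, ih]
    congr 2
    funext σ v
    cases v with
    | here => rfl
    | there v => simp [liftSubst]

/-- This identity turns instances of a quantified formula into extended substitutions, as the
quantifier clause `holds_all` requires. -/
theorem Fm.subst_liftSubst_inst {σ : FType} (φ : Fm (σ :: Γ)) (s : ∀ σ, Var Γ σ → Tm Δ σ)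
    (u : Tm Δ σ) : (φ.subst (liftSubst s σ)).inst u = φ.subst (consSubst u s) := by
  rw [Fm.inst, Fm.subst_subst]
  congr 1
  funext τ v
  cases v with
  | here => rfl
  | there v => simp [liftSubst, consSubst, Tm.subst_bvar]

theorem liftSubst_bvar (σ : FType) :
    liftSubst (fun _ v => Tm.bvar v : ∀ τ, Var Γ τ → Tm Γ τ) σ = fun _ v => Tm.bvar v := by
  funext τ v
  cases v <;> rfl

theorem Fm.subst_bvar (φ : Fm Γ) : φ.subst (fun _ v => .bvar v) = φ := by
  induction φ with
  | bot => rfl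
  | eq => simp [Fm.subst, Tm.subst_bvar]
  | imp φ ψ ih ih' => simp [Fm.subst, ih, ih']
  | all φ ih => simp [Fm.subst, liftSubst_bvar, ih]

end Substitution

/-! ## Fresh free variables -/

theorem Tm.exists_fresh {Γ : List FType} {τ : FType} (t : Tm Γ τ) :
    ∃ K, ∀ k, K ≤ k → ∀ σ, ¬ t.Occurs σ k := by
  induction t with
  | fvar σ k => exact ⟨k + 1, fun j hj σ' h => by have := h.2; omega⟩
  | app f a ihf iha =>
    obtain ⟨K, hK⟩ := ihf
    obtain ⟨K', hK'⟩ := iha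
    refine ⟨max K K', fun k hk σ h => h.elim (hK k (by omega) σ) (hK' k (by omega) σ)⟩
  | _ => exact ⟨0, fun _ _ _ h => h⟩

theorem Fm.exists_fresh {Γ : List FType} (φ : Fm Γ) :
    ∃ K, ∀ k, K ≤ k → ∀ σ, ¬ φ.Occurs σ k := by
  induction φ with
  | bot => exact ⟨0, fun _ _ _ h => h⟩
  | eq s t =>
    obtain ⟨K, hK⟩ := s.exists_fresh
    obtain ⟨K', hK'⟩ := t.exists_fresh
    refine ⟨max K K', fun k hk σ h => h.elim (hK k (by omega) σ) (hK' k (by omega) σ)⟩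
  | imp φ ψ ih ih' =>
    obtain ⟨K, hK⟩ := ih
    obtain ⟨K', hK'⟩ := ih'
    refine ⟨max K K', fun k hk σ h => h.elim (hK k (by omega) σ) (hK' k (by omega) σ)⟩
  | all φ ih => exact ih

theorem exists_fresh_list (Δ : List (Fm [])) :
    ∃ K, ∀ k, K ≤ k → ∀ φ ∈ Δ, ∀ σ, ¬ φ.Occurs σ k := by
  induction Δ with
  | nil => exact ⟨0, by simp⟩
  | cons φ Δ ih =>
    obtain ⟨K, hK⟩ := ih
    obtain ⟨K', hK'⟩ := φ.exists_fresh
    refine ⟨max K K', fun k hk ψ hψ => ?_⟩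
    rcases List.mem_cons.1 hψ with rfl | hψ
    · exact hK' k (by omega)
    · exact hK k (by omega) ψ hψ

/-! ## Henkin sets -/

section Henkin

variable {T : Set (Fm [])}

theorem Proves.cut {Δ : List (Fm [])} {φ ψ : Fm []} (d : Proves T Δ φ)
    (e : Proves T (φ :: Δ) ψ) : Proves T Δ ψ :=
  .impE (.impI e) d

theorem Proves.botE {Δ : List (Fm [])} {φ : Fm []} (d : Proves T Δ .bot) : Proves T Δ φ :=
  .raa (.weaken (List.subset_cons_self _ _) d)

/-- One Henkin step: keep ψ if that is consistent, otherwise add its negation. When a negated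
universal formula is kept, a fresh free variable is added as a counterexample. -/
theorem exists_henkin_extension {Δ : List (Fm [])} (hΔ : ¬ Proves T Δ .bot) (ψ : Fm []) :
    ∃ Δ' : List (Fm []), ¬ Proves T Δ' .bot ∧ Δ ⊆ Δ' ∧ (ψ ∈ Δ' ∨ ψ.neg ∈ Δ') ∧
      ∀ (σ : FType) (χ : Fm [σ]), ψ = (Fm.all χ).neg → ψ ∈ Δ' →
        ∃ t, (χ.inst t).neg ∈ Δ' := by
  by_cases h : Proves T (ψ :: Δ) .bot
  · have hn : Proves T Δ ψ.neg := .impI h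
    have hc : ¬ Proves T (ψ.neg :: Δ) .bot := fun d => hΔ (hn.cut d)
    refine ⟨ψ.neg :: Δ, hc, List.subset_cons_self _ _, .inr List.mem_cons_self, ?_⟩
    intro σ χ _ hψ
    exact (hc (.impE (.hyp List.mem_cons_self) (.hyp hψ))).elim
  · by_cases hψ : ∃ (σ : FType) (χ : Fm [σ]), ψ = (Fm.all χ).neg
    · obtain ⟨σ, χ, rfl⟩ := hψ
      obtain ⟨k, hk⟩ := exists_fresh_list ((Fm.all χ).neg :: Δ)
      refine ⟨(χ.inst (.fvar σ k)).neg :: (Fm.all χ).neg :: Δ, ?_, ?_, ?_, ?_⟩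
      · intro d
        -- If adding the counterexample were inconsistent, the instance at the fresh variable would
        -- be derivable, hence the universal formula by generalization, contradicting its kept
        -- negation.
        refine h (.impE (.hyp List.mem_cons_self)
          (.allI k (fun hχ => ?_) (fun θ hθ => hk k le_rfl θ hθ σ) (.raa d)))
        exact hk k le_rfl _ List.mem_cons_self σ (.inl hχ)
      · exact fun x hx => List.mem_cons_of_mem _ (List.mem_cons_of_mem _ hx)
      · exact .inl (by simp)
      · intro σ' χ' e _
        simp only [Fm.neg, Fm.imp.injEq, and_true, Fm.all.injEq] at e
        obtain ⟨rfl, e⟩ := e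
        cases e
        exact ⟨_, List.mem_cons_self⟩
    · exact ⟨ψ :: Δ, h, List.subset_cons_self _ _, .inl List.mem_cons_self,
        fun σ χ e => (hψ ⟨σ, χ, e⟩).elim⟩

/-- Maximal consistent sets of formulas that contain `T` and have witnesses. -/
structure IsHenkin (T H : Set (Fm [])) : Prop where
  subset : T ⊆ H
  bot : Fm.bot ∉ H
  imp : ∀ {φ ψ : Fm []}, (φ ⟶ ψ) ∈ H ↔ (φ ∈ H → ψ ∈ H)
  all : ∀ {σ : FType} {φ : Fm [σ]}, Fm.all φ ∈ H ↔ ∀ t, φ.inst t ∈ H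

/-- Iterate the Henkin step along an enumeration of all formulas, starting from the negation of φ,
and take everything derivable at some stage. Every formula is decided when its turn comes, which
gives the clauses for implication and quantifier. -/
theorem exists_isHenkin {φ : Fm []} (hφ : ¬ Proves T [] φ) :
    ∃ H, IsHenkin T H ∧ φ ∉ H := by
  have : Nonempty (Fm []) := ⟨.bot⟩
  obtain ⟨e, he⟩ := exists_surjective_nat (α := Fm [])
  choose next hcon hsub hdec hwit using
    fun (D : {Δ : List (Fm []) // ¬ Proves T Δ .bot}) => exists_henkin_extension D.2
  let D : ℕ → {Δ : List (Fm []) // ¬ Proves T Δ .bot} := fun n =>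
    Nat.rec ⟨[φ.neg], fun d => hφ (.raa d)⟩ (fun n D => ⟨next D (e n), hcon D (e n)⟩) n
  have hmono : Monotone fun n => {ψ | ψ ∈ (D n).1} :=
    monotone_nat_of_le_succ fun n => hsub (D n) (e n)
  let H : Set (Fm []) := {ψ | ∃ n, Proves T (D n).1 ψ}
  have mp : ∀ {ψ χ : Fm []}, (ψ ⟶ χ) ∈ H → ψ ∈ H → χ ∈ H := by
    rintro ψ χ ⟨n, hn⟩ ⟨m, hm⟩
    exact ⟨max n m, .impE (.weaken (hmono (le_max_left n m)) hn)
      (.weaken (hmono (le_max_right n m)) hm)⟩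
  have nobot : Fm.bot ∉ H := fun ⟨n, hn⟩ => (D n).2 hn
  have dec : ∀ ψ, ψ ∈ H ∨ ψ.neg ∈ H := by
    intro ψ
    obtain ⟨n, rfl⟩ := he ψ
    rcases hdec (D n) (e n) with h | h
    · exact .inl ⟨n + 1, .hyp h⟩
    · exact .inr ⟨n + 1, .hyp h⟩
  refine ⟨H, ⟨fun ψ h => ⟨0, .ax h⟩, nobot, ?_, ?_⟩, ?_⟩
  · intro ψ χ
    refine ⟨mp, fun h => ?_⟩
    rcases dec ψ with hψ | ⟨n, hn⟩
    · obtain ⟨n, hn⟩ := h hψ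
      exact ⟨n, .impI (.weaken (List.subset_cons_self _ _) hn)⟩
    · exact ⟨n, .impI (.botE (.impE (.weaken (List.subset_cons_self _ _) hn)
        (.hyp List.mem_cons_self)))⟩
  · intro σ χ
    refine ⟨fun ⟨n, hn⟩ t => ⟨n, .allE hn t⟩, fun h => ?_⟩
    -- Consider the stage that treats the negated universal formula: if it was kept, its
    -- counterexample refutes `h`; if it was rejected, its negation is present and classical logic
    -- yields the universal formula.
    obtain ⟨n, hn⟩ := he (Fm.all χ).neg
    rcases hdec (D n) (e n) with h' | h'
    · obtain ⟨t, ht⟩ := hwit (D n) (e n) σ χ hn h'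
      exact (nobot (mp ⟨n + 1, .hyp ht⟩ (h t))).elim
    · have hd : (e n).neg ∈ (D (n + 1)).1 := h'
      rw [hn] at hd
      exact ⟨n + 1, .raa (.impE (.weaken (List.subset_cons_self _ _) (.hyp hd))
        (.hyp List.mem_cons_self))⟩
  · exact fun h => nobot (mp ⟨0, .hyp List.mem_cons_self⟩ h)

end Henkin

end HORM

namespace HORM

/-! ## Extensional models -/

/-- Extensional models of the base theory. -/
structure Model where
  C : FType → Type
  app : ∀ {σ τ : FType}, C (σ ⇒ τ) → C σ → C τ
  zero : C T0
  succ : C T1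
  pi : ∀ σ τ, C (σ ⇒ τ ⇒ σ)
  sigma : ∀ δ ρ τ, C ((δ ⇒ ρ ⇒ τ) ⇒ (δ ⇒ ρ) ⇒ δ ⇒ τ)
  recursor : C (T0 ⇒ T0 ⇒ (T0 ⇒ T0 ⇒ T0) ⇒ T0)
  app_ext : ∀ {σ τ : FType} (f g : C (σ ⇒ τ)), (∀ a, app f a = app g a) → f = g
  pi_app : ∀ {σ τ : FType} (a : C σ) (b : C τ), app (app (pi σ τ) a) b = a
  sigma_app : ∀ {δ ρ τ : FType} (f : C (δ ⇒ ρ ⇒ τ)) (g : C (δ ⇒ ρ)) (a : C δ),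
    app (app (app (sigma δ ρ τ) f) g) a = app (app f a) (app g a)
  recursor_zero : ∀ a f, app (app (app recursor zero) a) f = a
  recursor_succ : ∀ n a f, app (app (app recursor (app succ n)) a) f =
    app (app f (app (app (app recursor n) a) f)) n
  succ_ne_zero : ∀ n, app succ n ≠ zero
  succ_inj : ∀ m n, app succ m = app succ n → m = n
  induction : ∀ f g h k : C T1, (app f zero = app g zero ∨ app h zero = app k zero) →
    (∀ n, app f n = app g n ∨ app h n = app k n →
      app f (app succ n) = app g (app succ n) ∨ app h (app succ n) = app k (app succ n)) →
    ∀ n, app f n = app g n ∨ app h n = app k n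
  choice : ∀ f : C (T1 ⇒ T0 ⇒ T0), (∀ a, ∃ n, app (app f a) n = zero) →
    ∃ F : C T2, ∀ a, app (app f a) (app F a) = zero

namespace Model

variable (M : Model) {Γ Δ : List FType} {σ τ : FType}

abbrev Env (Γ : List FType) : Type := ∀ σ, Var Γ σ → M.C σ

/-- Valuations of the free variables. -/
abbrev Val : Type := ∀ σ : FType, ℕ → M.C σ

variable {M}

def cons (a : M.C σ) (ρ : M.Env Γ) : M.Env (σ :: Γ)
  | _, .here => a
  | _, .there v => ρ _ v

variable (M) in
def nilEnv : M.Env [] := fun _ v => nomatch v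

def eval (ν : M.Val) (ρ : M.Env Γ) : {τ : FType} → Tm Γ τ → M.C τ
  | _, .bvar v => ρ _ v
  | _, .fvar σ k => ν σ k
  | _, .zero => M.zero
  | _, .succ => M.succ
  | _, .combPi σ τ => M.pi σ τ
  | _, .combSigma δ ρ τ => M.sigma δ ρ τ
  | _, .recursor => M.recursor
  | _, .app f a => M.app (eval ν ρ f) (eval ν ρ a)

/-- Satisfaction. -/
def Sat (ν : M.Val) : {Γ : List FType} → M.Env Γ → Fm Γ → Prop
  | _, _, .bot => False
  | _, ρ, .eq s t => eval ν ρ s = eval ν ρ t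
  | _, ρ, .imp φ ψ => Sat ν ρ φ → Sat ν ρ ψ
  | _, ρ, .all φ => ∀ a, Sat ν (cons a ρ) φ

variable {ν : M.Val} {ρ : M.Env Γ}

@[simp] theorem sat_eq {s t : Tm Γ T0} : Sat ν ρ (s ≐ t) ↔ eval ν ρ s = eval ν ρ t := Iff.rfl

@[simp] theorem sat_imp {φ ψ : Fm Γ} : Sat ν ρ (φ ⟶ ψ) ↔ (Sat ν ρ φ → Sat ν ρ ψ) := Iff.rfl

@[simp] theorem sat_all {φ : Fm (σ :: Γ)} : Sat ν ρ (.all φ) ↔ ∀ a, Sat ν (cons a ρ) φ := Iff.rfl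

@[simp] theorem sat_neg {φ : Fm Γ} : Sat ν ρ φ.neg ↔ ¬ Sat ν ρ φ := Iff.rfl

@[simp] theorem sat_and {φ ψ : Fm Γ} : Sat ν ρ (φ ⋀ ψ) ↔ Sat ν ρ φ ∧ Sat ν ρ ψ := by
  simp [Fm.and]

@[simp] theorem sat_iff {φ ψ : Fm Γ} : Sat ν ρ (φ ⟷ ψ) ↔ (Sat ν ρ φ ↔ Sat ν ρ ψ) := by
  simp [Fm.iff, iff_def]

@[simp] theorem sat_allQ {F : Tm (σ :: Γ) σ → Fm (σ :: Γ)} :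
    Sat ν ρ (allQ σ F) ↔ ∀ a, Sat ν (cons a ρ) (F (.bvar .here)) := Iff.rfl

@[simp] theorem sat_exQ {F : Tm (σ :: Γ) σ → Fm (σ :: Γ)} :
    Sat ν ρ (exQ σ F) ↔ ∃ a, Sat ν (cons a ρ) (F (.bvar .here)) := by
  simp [exQ]

end Model

/-! ## The term model of a Henkin set -/

section TermModel

variable {Γ Δ : List FType} {H : Set (Fm [])}

/-- Provable equality of closed terms at all types. -/
def TermEq (H : Set (Fm [])) : (σ : FType) → Tm [] σ → Tm [] σ → Prop
  | .nat, s, t => (s ≐ t) ∈ H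
  | .arr _ τ, s, t => ∀ u, TermEq H τ (s ⬝ u) (t ⬝ u)

theorem eqT_subst (σ : FType) : ∀ {Γ Δ : List FType} (s t : Tm Γ σ)
    (ρ : ∀ σ, Var Γ σ → Tm Δ σ),
    (eqT σ s t).subst ρ = eqT σ (s.subst ρ) (t.subst ρ) := by
  induction σ with
  | nat => intros; rfl
  | arr σ τ _ ih =>
    intro Γ Δ s t ρ
    simp [eqT, allQ, Fm.subst, ih, Tm.subst, liftSubst]

/-- `φ` belongs to `H` under a closed substitution. -/
def Holds (H : Set (Fm [])) (ρ : ∀ σ, Var Γ σ → Tm [] σ) (φ : Fm Γ) : Prop := φ.subst ρ ∈ H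

theorem holds_nil {ρ : ∀ σ, Var [] σ → Tm [] σ} {φ : Fm []} : Holds H ρ φ ↔ φ ∈ H := by
  have : ρ = fun _ v => .bvar v := by
    funext σ v
    cases v
  rw [Holds, this, Fm.subst_bvar]

variable {T : Set (Fm [])} (hH : IsHenkin T H) {ρ : ∀ σ, Var Γ σ → Tm [] σ}

include hH

theorem holds_imp {φ ψ : Fm Γ} : Holds H ρ (φ ⟶ ψ) ↔ (Holds H ρ φ → Holds H ρ ψ) := hH.imp

theorem holds_bot : ¬ Holds H ρ .bot := hH.bot

theorem holds_neg {φ : Fm Γ} : Holds H ρ φ.neg ↔ ¬ Holds H ρ φ := by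
  rw [Fm.neg, holds_imp hH]
  simp [holds_bot hH]

theorem holds_all {σ : FType} {φ : Fm (σ :: Γ)} :
    Holds H ρ (.all φ) ↔ ∀ t, Holds H (consSubst t ρ) φ := by
  simp only [Holds, Fm.subst, hH.all, Fm.subst_liftSubst_inst]

theorem holds_allQ {σ : FType} {F : Tm (σ :: Γ) σ → Fm (σ :: Γ)} :
    Holds H ρ (allQ σ F) ↔ ∀ t, Holds H (consSubst t ρ) (F (.bvar .here)) := holds_all hH

theorem holds_exQ {σ : FType} {F : Tm (σ :: Γ) σ → Fm (σ :: Γ)} :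
    Holds H ρ (exQ σ F) ↔ ∃ t, Holds H (consSubst t ρ) (F (.bvar .here)) := by
  simp [exQ, holds_neg hH, holds_allQ hH]

omit hH in
theorem holds_eq {s t : Tm Γ T0} :
    Holds H ρ (s ≐ t) ↔ TermEq H .nat (s.subst ρ) (t.subst ρ) := Iff.rfl

theorem mem_eqT (σ : FType) : ∀ s t : Tm [] σ, eqT σ s t ∈ H ↔ TermEq H σ s t := by
  induction σ with
  | nat => exact fun s t => Iff.rfl
  | arr σ τ _ ih =>
    intro s t
    simp only [eqT, allQ, hH.all, TermEq, ← ih]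
    simp only [Fm.inst, eqT_subst, Tm.subst, Tm.wk_subst_consSubst, Tm.subst_bvar, consSubst]

theorem holds_eqT {σ : FType} {s t : Tm Γ σ} :
    Holds H ρ (eqT σ s t) ↔ TermEq H σ (s.subst ρ) (t.subst ρ) := by
  rw [Holds, eqT_subst, mem_eqT hH]

variable (hT : ∀ φ, RCA0omega φ → φ ∈ T)

include hT

theorem holds_ax {φ : Fm []} (h : RCA0omega φ) : Holds H (fun _ v => .bvar v) φ :=
  holds_nil.2 (hH.subset (hT φ h))

theorem termEq_refl (σ : FType) : ∀ s : Tm [] σ, TermEq H σ s s := by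
  induction σ with
  | nat =>
    have := holds_ax hH hT .eq_refl
    simpa [holds_allQ hH, holds_eq, Tm.subst, consSubst] using this
  | arr σ τ _ ih => exact fun s u => ih _

theorem termEq_symm (σ : FType) : ∀ {s t : Tm [] σ}, TermEq H σ s t → TermEq H σ t s := by
  induction σ with
  | nat =>
    have := holds_ax hH hT .eq_symm
    simp only [holds_allQ hH, holds_imp hH, holds_eq, Tm.subst, consSubst,
      Tm.wk_subst_consSubst] at this
    exact fun {s t} => this s t
  | arr σ τ _ ih => exact fun h u => ih (h u)

theorem termEq_trans (σ : FType) :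
    ∀ {s t u : Tm [] σ}, TermEq H σ s t → TermEq H σ t u → TermEq H σ s u := by
  induction σ with
  | nat =>
    have := holds_ax hH hT .eq_trans
    simp only [holds_allQ hH, holds_imp hH, holds_eq, Tm.subst, consSubst,
      Tm.wk_subst_consSubst] at this
    exact fun {s t u} => this s t u
  | arr σ τ _ ih => exact fun h h' u => ih (h u) (h' u)

/-- The extensionality axioms enter here: without them application would not be well defined on
classes of terms. -/
theorem termEq_app {σ τ : FType} {f g : Tm [] (σ ⇒ τ)} {s t : Tm [] σ}
    (h : TermEq H (σ ⇒ τ) f g) (h' : TermEq H σ s t) : TermEq H τ (f ⬝ s) (g ⬝ t) := by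
  refine termEq_trans hH hT τ (h s) ?_
  have := holds_ax hH hT (.ext σ τ)
  simp only [holds_allQ hH, holds_imp hH, holds_eqT hH, Tm.subst, consSubst,
    Tm.wk_subst_consSubst] at this
  exact this g s t h'

/-- Closed terms up to provable equality. -/
def termSetoid (σ : FType) : Setoid (Tm [] σ) where
  r := TermEq H σ
  iseqv := ⟨termEq_refl hH hT σ, termEq_symm hH hT σ, termEq_trans hH hT σ⟩

def TermQuot (σ : FType) : Type := Quotient (termSetoid hH hT σ)

def TermQuot.mk {σ : FType} (t : Tm [] σ) : TermQuot hH hT σ := Quotient.mk _ t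

theorem TermQuot.mk_eq {σ : FType} {s t : Tm [] σ} :
    TermQuot.mk hH hT s = TermQuot.mk hH hT t ↔ TermEq H σ s t :=
  ⟨fun h => Quotient.exact h, fun h => Quotient.sound h⟩

theorem TermQuot.exists_mk {σ : FType} (a : TermQuot hH hT σ) : ∃ t, a = TermQuot.mk hH hT t :=
  ⟨a.out, (Quotient.out_eq a).symm⟩

def TermQuot.app {σ τ : FType} (f : TermQuot hH hT (σ ⇒ τ)) (a : TermQuot hH hT σ) :
    TermQuot hH hT τ :=
  Quotient.map₂ Tm.app (fun _ _ h _ _ h' => termEq_app hH hT h h') f a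

theorem TermQuot.app_mk {σ τ : FType} (f : Tm [] (σ ⇒ τ)) (a : Tm [] σ) :
    (TermQuot.mk hH hT f).app hH hT (.mk hH hT a) = .mk hH hT (f ⬝ a) := rfl

/-- A disjunction of two equations is the quantifier-free formula ¬A → B. This disjunctive form
yields the case distinctions of arithmetic before any characteristic functions are available. -/
theorem termEq_induction (f g h k : Tm [] T1)
    (h0 : TermEq H .nat (f ⬝ .zero) (g ⬝ .zero) ∨ TermEq H .nat (h ⬝ .zero) (k ⬝ .zero))
    (hs : ∀ n, TermEq H .nat (f ⬝ n) (g ⬝ n) ∨ TermEq H .nat (h ⬝ n) (k ⬝ n) →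
      TermEq H .nat (f ⬝ (.succ ⬝ n)) (g ⬝ (.succ ⬝ n)) ∨
        TermEq H .nat (h ⬝ (.succ ⬝ n)) (k ⬝ (.succ ⬝ n)))
    (n : Tm [] T0) : TermEq H .nat (f ⬝ n) (g ⬝ n) ∨ TermEq H .nat (h ⬝ n) (k ⬝ n) := by
  have := holds_ax hH hT (.qfInd (Fm.neg (f.wk ⬝ .bvar .here ≐ g.wk ⬝ .bvar .here) ⟶
    (h.wk ⬝ .bvar .here ≐ k.wk ⬝ .bvar .here)) ⟨⟨trivial, trivial⟩, trivial⟩)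
  have hw : ∀ (f : Tm [] T1) (n : Tm [] T0),
      (f.subst fun _ v => (.bvar (.there v) : Tm [T0] _)).subst
        (consSubst n fun _ v => .bvar v) = f := by
    intro f n
    simp only [Tm.subst_subst, Tm.subst, consSubst, Tm.subst_bvar]
  simp only [holds_imp hH, holds_all hH, Fm.inst, Fm.subst, Tm.subst, Tm.wk_subst_consSubst,
    holds_eq, consSubst, Tm.subst_bvar, Fm.neg, holds_bot hH, hw, imp_false,
    ← or_iff_not_imp_left] at this
  exact this h0 hs n

theorem termEq_choice (f : Tm [] (T1 ⇒ T0 ⇒ T0))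
    (h : ∀ a, ∃ n, TermEq H .nat (f ⬝ a ⬝ n) .zero) :
    ∃ F : Tm [] T2, ∀ a, TermEq H .nat (f ⬝ a ⬝ (F ⬝ a)) .zero := by
  have := holds_ax hH hT (.qfAC (f.wk.wk ⬝ .bvar (.there .here) ⬝ .bvar .here ≐ .zero) trivial)
  simp only [holds_imp hH, holds_allQ hH, holds_exQ hH, holds_all hH, holds_neg hH, Fm.subst,
    Tm.subst, Tm.wk_subst_consSubst, holds_eq, consSubst, Tm.subst_bvar, not_forall,
    not_not] at this
  obtain ⟨F, hF⟩ := this h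
  refine ⟨F, fun a => ?_⟩
  have hs : (f.subst fun _ v => (.bvar (.there (.there v)) : Tm [T1, T2] _)).subst
      (consSubst a (consSubst F fun _ v => .bvar v)) = f := by
    simp only [Tm.subst_subst, Tm.subst, consSubst, Tm.subst_bvar]
  simpa only [hs] using hF a

/-- The term model. -/
def termModel : Model where
  C := TermQuot hH hT
  app := TermQuot.app hH hT
  zero := .mk hH hT .zero
  succ := .mk hH hT .succ
  pi σ τ := .mk hH hT (.combPi σ τ)
  sigma δ ρ τ := .mk hH hT (.combSigma δ ρ τ)
  recursor := .mk hH hT .recursor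
  -- Equality at arrow types is pointwise by definition, and every element is the class of a term.
  app_ext f g h := by
    obtain ⟨f, rfl⟩ := f.exists_mk
    obtain ⟨g, rfl⟩ := g.exists_mk
    exact (TermQuot.mk_eq hH hT).2 fun u => (TermQuot.mk_eq hH hT).1 (h (.mk hH hT u))
  pi_app {σ τ} a b := by
    obtain ⟨a, rfl⟩ := a.exists_mk
    obtain ⟨b, rfl⟩ := b.exists_mk
    simp only [TermQuot.app_mk, TermQuot.mk_eq]
    have := holds_ax hH hT (.combPi σ τ)
    simp only [holds_allQ hH, holds_eqT hH, Tm.subst, consSubst, Tm.wk_subst_consSubst] at this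
    exact this a b
  sigma_app {δ ρ τ} f g a := by
    obtain ⟨f, rfl⟩ := f.exists_mk
    obtain ⟨g, rfl⟩ := g.exists_mk
    obtain ⟨a, rfl⟩ := a.exists_mk
    simp only [TermQuot.app_mk, TermQuot.mk_eq]
    have := holds_ax hH hT (.combSigma δ ρ τ)
    simp only [holds_allQ hH, holds_eqT hH, Tm.subst, consSubst, Tm.wk_subst_consSubst] at this
    exact this f g a
  recursor_zero a f := by
    obtain ⟨f, rfl⟩ := f.exists_mk
    obtain ⟨a, rfl⟩ := a.exists_mk
    simp only [TermQuot.app_mk, TermQuot.mk_eq]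
    have := holds_ax hH hT .rec_zero
    simp only [holds_allQ hH, holds_eq, Tm.subst, consSubst, Tm.wk_subst_consSubst] at this
    exact this a f
  recursor_succ n a f := by
    obtain ⟨n, rfl⟩ := n.exists_mk
    obtain ⟨f, rfl⟩ := f.exists_mk
    obtain ⟨a, rfl⟩ := a.exists_mk
    simp only [TermQuot.app_mk, TermQuot.mk_eq]
    have := holds_ax hH hT .rec_succ
    simp only [holds_allQ hH, holds_eq, Tm.subst, consSubst, Tm.wk_subst_consSubst] at this
    exact this n a f
  succ_ne_zero n := by
    obtain ⟨n, rfl⟩ := n.exists_mk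
    simp only [TermQuot.app_mk, ne_eq, TermQuot.mk_eq]
    have := holds_ax hH hT .succ_ne_zero
    simp only [holds_allQ hH, holds_neg hH, holds_eq, Tm.subst, consSubst] at this
    exact this n
  succ_inj m n := by
    obtain ⟨m, rfl⟩ := m.exists_mk
    obtain ⟨n, rfl⟩ := n.exists_mk
    simp only [TermQuot.app_mk, TermQuot.mk_eq]
    have := holds_ax hH hT .succ_inj
    simp only [holds_allQ hH, holds_imp hH, holds_eq, Tm.subst, consSubst,
      Tm.wk_subst_consSubst] at this
    exact this m n
  induction f g h k h0 hs n := by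
    obtain ⟨f, rfl⟩ := f.exists_mk
    obtain ⟨g, rfl⟩ := g.exists_mk
    obtain ⟨h, rfl⟩ := h.exists_mk
    obtain ⟨k, rfl⟩ := k.exists_mk
    obtain ⟨n, rfl⟩ := n.exists_mk
    simp only [TermQuot.app_mk, TermQuot.mk_eq] at h0 ⊢
    refine termEq_induction hH hT f g h k h0 (fun n hn => ?_) n
    have := hs (.mk hH hT n)
    simp only [TermQuot.app_mk, TermQuot.mk_eq] at this
    exact this hn
  choice f h := by
    obtain ⟨f, rfl⟩ := f.exists_mk
    have h' : ∀ a, ∃ n, TermEq H .nat (f ⬝ a ⬝ n) .zero := by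
      intro a
      obtain ⟨n, hn⟩ := h (.mk hH hT a)
      obtain ⟨n, rfl⟩ := n.exists_mk
      exact ⟨n, (TermQuot.mk_eq hH hT).1 hn⟩
    obtain ⟨F, hF⟩ := termEq_choice hH hT f h'
    refine ⟨.mk hH hT F, fun a => ?_⟩
    obtain ⟨a, rfl⟩ := a.exists_mk
    exact (TermQuot.mk_eq hH hT).2 (hF a)

/-- The free variables denote themselves. -/
def termVal : (termModel hH hT).Val := fun σ k => TermQuot.mk hH hT (.fvar σ k)

/-- The environment given by a closed substitution. -/
def termEnv (ρ : ∀ σ, Var Γ σ → Tm [] σ) : (termModel hH hT).Env Γ :=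
  fun σ v => TermQuot.mk hH hT (ρ σ v)

theorem termModel_eval {τ : FType} (t : Tm Γ τ) (ρ : ∀ σ, Var Γ σ → Tm [] σ) :
    Model.eval (termVal hH hT) (termEnv hH hT ρ) t =
      TermQuot.mk hH hT (t.subst ρ) := by
  induction t with
  | app f a ihf iha =>
    simp only [Model.eval, ihf, iha]
    rfl
  | _ => rfl

/-- The truth lemma. In the quantifier case, elements of the model correspond to terms, and
membership of a universal formula in the Henkin set amounts to membership of all its instances. -/
theorem termModel_sat (φ : Fm Γ) : ∀ ρ : ∀ σ, Var Γ σ → Tm [] σ,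
    Model.Sat (termVal hH hT) (termEnv hH hT ρ) φ ↔ Holds H ρ φ := by
  induction φ with
  | bot => exact fun ρ => iff_of_false id hH.bot
  | eq s t =>
    intro ρ
    rw [Model.sat_eq, termModel_eval, termModel_eval, holds_eq]
    exact TermQuot.mk_eq hH hT
  | imp φ ψ ih ih' =>
    intro ρ
    rw [holds_imp hH, ← ih, ← ih', Model.sat_imp]
  | @all Γ σ φ ih =>
    intro ρ
    have hc : ∀ u : Tm [] σ, (Model.cons (M := termModel hH hT) (TermQuot.mk hH hT u)
        (termEnv hH hT ρ)) = termEnv hH hT (consSubst u ρ) := by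
      intro u
      funext τ v
      cases v <;> rfl
    rw [holds_all hH, Model.sat_all]
    refine ⟨fun h u => (ih _).1 (hc u ▸ h (.mk hH hT u)), fun h a => ?_⟩
    obtain ⟨u, rfl⟩ := TermQuot.exists_mk hH hT a
    rw [hc u, ih]
    exact h u

end TermModel

/-- Completeness with respect to extensional models. -/
theorem proves_of_sat {T : Set (Fm [])} (hT : ∀ φ, RCA0omega φ → φ ∈ T) {φ : Fm []}
    (h : ∀ (M : Model) (ν : M.Val), (∀ ψ ∈ T, Model.Sat ν M.nilEnv ψ) →
      Model.Sat ν M.nilEnv φ) : Proves T [] φ := by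
  by_contra hφ
  obtain ⟨H, hH, hφH⟩ := exists_isHenkin hφ
  have key : ∀ ψ, Model.Sat (termVal hH hT) (termModel hH hT).nilEnv ψ ↔ ψ ∈ H := by
    intro ψ
    have he : (termModel hH hT).nilEnv = termEnv hH hT fun _ v => .bvar v := by
      funext σ v
      cases v
    rw [he, termModel_sat, holds_nil]
  exact hφH ((key φ).1 (h _ _ fun ψ hψ => (key ψ).2 (hH.subset hψ)))

end HORM

namespace HORM

namespace Model

variable {M : Model} {Γ Δ : List FType} {σ τ υ : FType}

/-- Application. -/
def ap (f : M.C (σ ⇒ τ)) (a : M.C σ) : M.C τ := M.app f a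

end Model

infixl:90 " ⊙ " => Model.ap

namespace Model

variable {M : Model} {Γ Δ : List FType} {σ τ υ : FType}

theorem ap_ext {f g : M.C (σ ⇒ τ)} (h : ∀ a, f ⊙ a = g ⊙ a) : f = g := M.app_ext f g h

@[simp] theorem pi_ap (a : M.C σ) (b : M.C τ) : M.pi σ τ ⊙ a ⊙ b = a := M.pi_app a b

@[simp] theorem sigma_ap {δ ρ : FType} (f : M.C (δ ⇒ ρ ⇒ τ)) (g : M.C (δ ⇒ ρ)) (a : M.C δ) :
    M.sigma δ ρ τ ⊙ f ⊙ g ⊙ a = f ⊙ a ⊙ (g ⊙ a) := M.sigma_app f g a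

theorem nonempty_C : ∀ σ, Nonempty (M.C σ)
  | .nat => ⟨M.zero⟩
  | .arr σ τ => (nonempty_C τ).map fun a => M.pi τ σ ⊙ a

instance : Nonempty (M.C σ) := nonempty_C σ

/-! ## Definable functions -/

/-- Finite products of the domains of a model, with the functions that are definable on them. -/
class Ctx (M : outParam Model) (X : Type) where
  Def : ∀ {τ : FType}, (X → M.C τ) → Prop
  const : ∀ {τ : FType} (c : M.C τ), Def fun _ => c
  ap : ∀ {σ τ : FType} {f : X → M.C (σ ⇒ τ)} {g : X → M.C σ}, Def f → Def g →
    Def fun x => f x ⊙ g x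

/-- The empty product. -/
inductive Pt (M : Model) : Type
  | pt

/-- Every function on a one-point space is constant, so there is nothing to require. -/
instance : Ctx M M.Pt where
  Def _ := True
  const _ := trivial
  ap _ _ := trivial

/-- Combinatory completeness, with elements of the model as parameters: definable means having a
definable curried form. The combinator `Π` supplies constants and `Σ` supplies closure under
application. -/
instance {X : Type} [Ctx M X] : Ctx M (X × M.C σ) where
  Def F := ∃ G, Ctx.Def G ∧ ∀ x y, F (x, y) = G x ⊙ y
  const c := ⟨_, Ctx.const (M.pi _ _ ⊙ c), by simp⟩
  ap := fun ⟨G, hG, h⟩ ⟨G', hG', h'⟩ =>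
    ⟨_, Ctx.ap (Ctx.ap (Ctx.const (M.sigma _ _ _)) hG) hG', by simp [h, h']⟩

/-- Definability of a function. -/
class IsDef {X : Type} [Ctx M X] (F : X → M.C τ) : Prop where
  out : Ctx.Def F

section IsDef

variable {X : Type} [Ctx M X]

instance IsDef.const (c : M.C τ) : IsDef fun _ : X => c := ⟨Ctx.const c⟩

instance IsDef.ap {f : X → M.C (σ ⇒ τ)} {g : X → M.C σ} [hf : IsDef f] [hg : IsDef g] :
    IsDef fun x => f x ⊙ g x := ⟨Ctx.ap hf.out hg.out⟩

theorem IsDef.fst {F : X → M.C τ} (h : IsDef F) : IsDef fun p : X × M.C σ => F p.1 :=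
  ⟨_, Ctx.ap (Ctx.const (M.pi _ _)) h.out, by simp⟩

instance IsDef.snd : IsDef fun p : X × M.C σ => p.2 :=
  ⟨_, Ctx.const (M.sigma _ _ _ ⊙ M.pi σ (σ ⇒ σ) ⊙ M.pi _ _), by simp⟩

variable {α β γ δ : FType}

instance : IsDef fun p : (X × M.C α) × M.C β => p.1.2 := IsDef.snd.fst
instance : IsDef fun p : ((X × M.C α) × M.C β) × M.C γ => p.1.1.2 := IsDef.snd.fst.fst
instance : IsDef fun p : (((X × M.C α) × M.C β) × M.C γ) × M.C δ => p.1.1.1.2 :=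
  IsDef.snd.fst.fst.fst
/-- Abstraction: the object with the given values. -/
noncomputable def lam (F : M.C σ → M.C τ) : M.C (σ ⇒ τ) :=
  Classical.epsilon fun e => ∀ x, F x = e ⊙ x

theorem lam_eq {F : M.C σ → M.C τ} {e : M.C (σ ⇒ τ)} (h : ∀ x, F x = e ⊙ x) : lam F = e :=
  ap_ext fun x => by rw [← h x, Classical.epsilon_spec (⟨e, h⟩ : ∃ e, ∀ x, F x = e ⊙ x) x, lam]

-- Beta reduction, with definability as the side condition discharged by instance search; without an
-- object having the prescribed values, `lam` is arbitrary.
@[simp] theorem lam_ap (F : M.C σ → M.C τ) [h : IsDef fun p : M.Pt × M.C σ => F p.2] (x : M.C σ) :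
    lam F ⊙ x = F x := by
  obtain ⟨G, -, h⟩ := h.out
  rw [lam_eq (h .pt), ← h .pt]

instance IsDef.lam {F : X → M.C σ → M.C τ} [h : IsDef fun p : X × M.C σ => F p.1 p.2] :
    IsDef fun x => lam (F x) := by
  obtain ⟨G, hG, h⟩ := h.out
  have : (fun x => Model.lam (F x)) = G := funext fun x => lam_eq (h x)
  exact ⟨this ▸ hG⟩

end IsDef

/-! ## Evaluation -/

section Eval

variable {ν : M.Val} {ρ : M.Env Γ}

@[simp] theorem eval_here {a : M.C σ} : eval ν (cons a ρ) (.bvar .here) = a := rfl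

@[simp] theorem eval_there {a : M.C σ} {v : Var Γ τ} :
    eval ν (cons a ρ) (.bvar (.there v)) = eval ν ρ (.bvar v) := rfl

@[simp] theorem eval_app {f : Tm Γ (σ ⇒ τ)} {t : Tm Γ σ} :
    eval ν ρ (f ⬝ t) = eval ν ρ f ⊙ eval ν ρ t := rfl

@[simp] theorem eval_fvar {k : ℕ} : eval ν ρ (.fvar σ k) = ν σ k := rfl

@[simp] theorem eval_zero : eval ν ρ (.zero) = M.zero := rfl

@[simp] theorem eval_succ : eval ν ρ (.succ) = M.succ := rfl

@[simp] theorem eval_combPi : eval ν ρ (.combPi σ τ) = M.pi σ τ := rfl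

@[simp] theorem eval_recursor : eval ν ρ (.recursor) = M.recursor := rfl

@[simp] theorem eval_combSigma {δ : FType} :
    eval ν ρ (.combSigma δ σ τ) = M.sigma δ σ τ := rfl

theorem eval_subst (s : ∀ σ, Var Γ σ → Tm Δ σ) (ρ : M.Env Δ) (t : Tm Γ τ) :
    eval ν ρ (t.subst s) = eval ν (fun σ v => eval ν ρ (s σ v)) t := by
  induction t with
  | app f a ihf iha => simp [Tm.subst, ihf, iha]
  | _ => rfl

@[simp] theorem eval_wk {a : M.C σ} {t : Tm Γ τ} : eval ν (cons a ρ) t.wk = eval ν ρ t := by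
  rw [Tm.wk, eval_subst]
  rfl

/-- Bracket abstraction on terms computes correctly. By extensionality this identifies the value of
an abstraction term with the semantic `lam`, with no separate definability argument. -/
theorem eval_lam_ap : ∀ {τ : FType} (t : Tm (σ :: Γ) τ) (a : M.C σ),
    eval ν ρ t.lam ⊙ a = eval ν (cons a ρ) t
  | _, .bvar .here, a => by simp [Tm.lam]
  | _, .bvar (.there v), a => by simp [Tm.lam]
  | _, .fvar σ k, a => by simp [Tm.lam]
  | _, .zero, a => by simp [Tm.lam]
  | _, .succ, a => by simp [Tm.lam]
  | _, .combPi ρ τ, a => by simp [Tm.lam]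
  | _, .combSigma δ ρ τ, a => by simp [Tm.lam]
  | _, .recursor, a => by simp [Tm.lam]
  | _, .app f b, a => by simp [Tm.lam, eval_lam_ap f, eval_lam_ap b]

@[simp] theorem eval_lam {t : Tm (σ :: Γ) τ} :
    eval ν ρ t.lam = lam fun a => eval ν (cons a ρ) t :=
  (lam_eq fun a => (eval_lam_ap t a).symm).symm

@[simp] theorem eval_lamQ {F : Tm (σ :: Γ) σ → Tm (σ :: Γ) τ} :
    eval ν ρ (lamQ σ F) = lam fun a => eval ν (cons a ρ) (F (.bvar .here)) := eval_lam

@[simp] theorem sat_eqT : ∀ {σ : FType} {Γ : List FType} {ρ : M.Env Γ} {s t : Tm Γ σ},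
    Sat ν ρ (eqT σ s t) ↔ eval ν ρ s = eval ν ρ t
  | .nat, _, _, _, _ => Iff.rfl
  | .arr σ τ, _, _, _, _ => by
    simp only [eqT, sat_allQ, sat_eqT, eval_app, eval_wk, eval_here]
    exact ⟨ap_ext, fun h a => by rw [h]⟩

end Eval

end Model

end HORM

namespace HORM

namespace Model

variable {M : Model} {Γ : List FType} {X : Type} [Ctx M X]

/-! ## Arithmetic in a model -/

instance : Zero (M.C T0) := ⟨M.zero⟩

@[simp] theorem zero_eq : M.zero = 0 := rfl

/-- The successor function. -/
def S (n : M.C T0) : M.C T0 := M.succ ⊙ n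

@[simp] theorem succ_ap (n : M.C T0) : M.succ ⊙ n = S n := rfl

theorem S_ne_zero (n : M.C T0) : S n ≠ 0 := M.succ_ne_zero n

instance {f : X → M.C T0} [IsDef f] : IsDef fun x => S (f x) := IsDef.ap

theorem or_induction {f g h k : M.C T0 → M.C T0} [IsDef fun p : M.Pt × M.C T0 => f p.2]
    [IsDef fun p : M.Pt × M.C T0 => g p.2] [IsDef fun p : M.Pt × M.C T0 => h p.2]
    [IsDef fun p : M.Pt × M.C T0 => k p.2]
    (h0 : f 0 = g 0 ∨ h 0 = k 0)
    (hs : ∀ n, f n = g n ∨ h n = k n → f (S n) = g (S n) ∨ h (S n) = k (S n)) (n : M.C T0) :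
    f n = g n ∨ h n = k n := by
  have := M.induction (lam f) (lam g) (lam h) (lam k)
  simp only [← ap.eq_1, lam_ap] at this
  exact this h0 hs n

theorem eq_induction {f g : M.C T0 → M.C T0} [IsDef fun p : M.Pt × M.C T0 => f p.2]
    [IsDef fun p : M.Pt × M.C T0 => g p.2]
    (h0 : f 0 = g 0) (hs : ∀ n, f n = g n → f (S n) = g (S n)) (n : M.C T0) : f n = g n :=
  or_self_iff.1 (or_induction (.inl h0) (fun n h => .inl (hs n (or_self_iff.1 h))) n)

/-- Primitive recursion. -/
noncomputable def natrec (n b : M.C T0) (f : M.C T0 → M.C T0 → M.C T0) : M.C T0 :=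
  M.recursor ⊙ n ⊙ b ⊙ lam fun u => lam fun v => f u v

section

variable {b : M.C T0} {f : M.C T0 → M.C T0 → M.C T0}

@[simp] theorem natrec_zero : natrec 0 b f = b := M.recursor_zero _ _

@[simp] theorem natrec_S [h : IsDef fun p : (M.Pt × M.C T0) × M.C T0 => f p.1.2 p.2]
    (n : M.C T0) : natrec (S n) b f = f (natrec n b f) n := by
  obtain ⟨G, -, hG⟩ := h.out
  have h' : ∀ u v, f u v = G (.pt, u) ⊙ v := fun u v => hG (.pt, u) v
  -- Reducing the inner abstraction needs definability with u fixed as a parameter.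
  have hu (u : M.C T0) : IsDef fun p : M.Pt × M.C T0 => f u p.2 :=
    ⟨_, Ctx.const (G (.pt, u)), fun _ v => h' u v⟩
  refine (M.recursor_succ _ _ _).trans ?_
  change (lam fun u => lam fun v => f u v) ⊙ natrec n b f ⊙ n = _
  simp only [lam_ap]

end

instance {n b : X → M.C T0} {f : X → M.C T0 → M.C T0 → M.C T0} [IsDef n] [IsDef b]
    [IsDef fun p : (X × M.C T0) × M.C T0 => f p.1.1 p.1.2 p.2] :
    IsDef fun x => natrec (n x) (b x) (f x) := by
  unfold natrec
  infer_instance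

@[simp] theorem eval_natRec {ν : M.Val} {ρ : M.Env Γ} {n b : Tm Γ T0}
    {step : Tm (T0 :: T0 :: Γ) T0 → Tm (T0 :: T0 :: Γ) T0 → Tm (T0 :: T0 :: Γ) T0} :
    eval ν ρ (natRec n b step) = natrec (eval ν ρ n) (eval ν ρ b) fun u v =>
      eval ν (cons v (cons u ρ)) (step (.bvar (.there .here)) (.bvar .here)) := by
  simp only [natRec, eval_app, eval_lamQ, eval_recursor, natrec]
  rfl

/-- The predecessor. -/
noncomputable def prd (n : M.C T0) : M.C T0 := natrec n 0 fun _ v => v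

noncomputable instance : Add (M.C T0) := ⟨fun m n => natrec n m fun u _ => S u⟩

theorem add_def (m n : M.C T0) : m + n = natrec n m fun u _ => S u := rfl

instance {f g : X → M.C T0} [IsDef f] [IsDef g] : IsDef fun x => f x + g x := by
  simp only [add_def]; infer_instance

instance {f : X → M.C T0} [IsDef f] : IsDef fun x => prd (f x) := by
  unfold prd; infer_instance

noncomputable instance : Mul (M.C T0) := ⟨fun m n => natrec n 0 fun u _ => u + m⟩

theorem mul_def (m n : M.C T0) : m * n = natrec n 0 fun u _ => u + m := rfl

instance {f g : X → M.C T0} [hf : IsDef f] [IsDef g] : IsDef fun x => f x * g x := by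
  have := (hf.fst (σ := T0)).fst (σ := T0)
  simp only [mul_def]; infer_instance

noncomputable instance : Sub (M.C T0) := ⟨fun m n => natrec n m fun u _ => prd u⟩

theorem sub_def (m n : M.C T0) : m - n = natrec n m fun u _ => prd u := rfl

instance {f g : X → M.C T0} [IsDef f] [IsDef g] : IsDef fun x => f x - g x := by
  simp only [sub_def]; infer_instance

instance : One (M.C T0) := ⟨S 0⟩

theorem one_def : (1 : M.C T0) = S 0 := rfl

/-! ### Peano arithmetic from definable induction -/

section Peano

variable (a b c : M.C T0)

@[simp] theorem prd_zero : prd (0 : M.C T0) = 0 := natrec_zero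
@[simp] theorem prd_S : prd (S a) = a := natrec_S _

/-- At a successor the second alternative always holds, so the induction step ignores its
hypothesis. -/
theorem eq_zero_or_eq_S (n : M.C T0) : n = 0 ∨ ∃ m, n = S m := by
  refine (or_induction (f := fun n => n) (g := fun _ => 0) (h := fun n => n)
    (k := fun n => S (prd n)) (.inl rfl) (fun n _ => .inr ?_) n).imp_right fun h => ⟨_, h⟩
  rw [prd_S]

theorem add_zero' : a + 0 = a := natrec_zero
theorem add_S : a + S b = S (a + b) := natrec_S _
theorem mul_zero' : a * 0 = 0 := natrec_zero
theorem mul_S : a * S b = a * b + a := natrec_S _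
theorem sub_zero' : a - 0 = a := natrec_zero
theorem sub_S : a - S b = prd (a - b) := natrec_S _

theorem zero_add' : 0 + a = a :=
  eq_induction (f := fun a => 0 + a) (g := fun a => a) (add_zero' 0)
    (fun n h => by rw [add_S, h]) a

theorem S_add : S a + b = S (a + b) :=
  eq_induction (f := fun b => S a + b) (g := fun b => S (a + b)) (by simp only [add_zero'])
    (fun n h => by simp only [add_S, h]) b

theorem add_comm' : a + b = b + a :=
  eq_induction (f := fun b => a + b) (g := fun b => b + a) (by simp only [add_zero', zero_add'])
    (fun n h => by simp only [add_S, S_add, h]) b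

theorem add_assoc' : a + b + c = a + (b + c) :=
  eq_induction (f := fun c => a + b + c) (g := fun c => a + (b + c)) (by simp only [add_zero'])
    (fun n h => by simp only [add_S, h]) c

theorem zero_mul' : 0 * a = 0 :=
  eq_induction (f := fun a => 0 * a) (g := fun _ => 0) (mul_zero' 0)
    (fun n h => by simp only [mul_S, h, add_zero']) a

theorem S_mul : S a * b = a * b + b :=
  eq_induction (f := fun b => S a * b) (g := fun b => a * b + b)
    (by simp only [mul_zero', add_zero'])
    (fun n h => by
      simp only [mul_S, h, add_S]
      rw [add_assoc', add_comm' n a, ← add_assoc']) b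

theorem mul_comm' : a * b = b * a :=
  eq_induction (f := fun b => a * b) (g := fun b => b * a) (by simp only [mul_zero', zero_mul'])
    (fun n h => by simp only [mul_S, S_mul, h]) b

theorem mul_add' : a * (b + c) = a * b + a * c :=
  eq_induction (f := fun c => a * (b + c)) (g := fun c => a * b + a * c)
    (by simp only [mul_zero', add_zero'])
    (fun n h => by simp only [add_S, mul_S, h, add_assoc']) c

theorem mul_assoc' : a * b * c = a * (b * c) :=
  eq_induction (f := fun c => a * b * c) (g := fun c => a * (b * c)) (by simp only [mul_zero'])
    (fun n h => by simp only [mul_S, mul_add', h]) c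

theorem mul_one' : a * 1 = a := by rw [one_def, mul_S, mul_zero', zero_add']

end Peano

noncomputable instance : CommSemiring (M.C T0) where
  add_assoc := add_assoc'
  zero_add := zero_add'
  add_zero := add_zero'
  add_comm := add_comm'
  left_distrib := mul_add'
  right_distrib a b c := by rw [mul_comm', mul_add', mul_comm' c, mul_comm' c]
  zero_mul := zero_mul'
  mul_zero := mul_zero'
  mul_assoc := mul_assoc'
  one_mul a := by rw [mul_comm', mul_one']
  mul_one := mul_one'
  mul_comm := mul_comm'
  nsmul := nsmulRec
  npow := npowRec

theorem S_eq (n : M.C T0) : S n = n + 1 := by rw [one_def, add_S, add_zero]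

theorem succ_sub_succ (a b : M.C T0) : S a - S b = a - b :=
  eq_induction (f := fun b => S a - S b) (g := fun b => a - b)
    (by simp only [sub_S, sub_zero', prd_S]) (fun n h => by
      rw [sub_S, h, sub_S a n]) b

theorem sub_self' (a : M.C T0) : a - a = 0 :=
  eq_induction (f := fun a => a - a) (g := fun _ => 0) (sub_zero' _)
    (fun n h => by simp only [succ_sub_succ, h]) a

theorem zero_sub' (a : M.C T0) : 0 - a = 0 :=
  eq_induction (f := fun a => 0 - a) (g := fun _ => 0) (sub_zero' _)
    (fun n h => by simp only [sub_S, h, prd_zero]) a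

theorem add_sub_cancel' (a b : M.C T0) : a + b - b = a :=
  eq_induction (f := fun b => a + b - b) (g := fun _ => a) (by simp only [sub_zero', add_zero])
    (fun n h => by simp only [add_S, succ_sub_succ, h]) b

theorem sub_add' (a b c : M.C T0) : a - (b + c) = a - b - c :=
  eq_induction (f := fun c => a - (b + c)) (g := fun c => a - b - c)
    (by simp only [sub_zero', add_zero]) (fun n h => by simp only [add_S, sub_S, h]) c

/-- This disjunctive induction gives the totality of the order: of two numbers, one is the other
plus a truncated difference. -/
theorem eq_add_sub_or (a b : M.C T0) : b = a + (b - a) ∨ a = b + (a - b) := by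
  refine or_induction (f := fun _ => b) (g := fun a => a + (b - a)) (h := fun a => a)
    (k := fun a => b + (a - b)) (.inl ?_) (fun a h => ?_) a
  · simp only [sub_zero', zero_add]
  · rcases h with h | h
    · rcases eq_zero_or_eq_S (b - a) with h' | ⟨j, h'⟩
      · rw [h', add_zero] at h
        right
        rw [h]
        have := add_sub_cancel' 1 a
        rw [add_comm, ← S_eq] at this
        rw [this, S_eq]
      · left
        rw [sub_S, h', prd_S, S_add, ← add_S, ← h', ← h]
    · right
      have : S a - b = S (a - b) := by
        conv_lhs => rw [h, ← add_S, add_comm, add_sub_cancel']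
      rw [this, add_S, ← h]

instance : LE (M.C T0) := ⟨fun a b => a - b = 0⟩

theorem le_def {a b : M.C T0} : a ≤ b ↔ a - b = 0 := Iff.rfl

theorem le_iff_exists_add' {a b : M.C T0} : a ≤ b ↔ ∃ c, b = a + c := by
  rw [le_def]
  constructor
  · intro h
    rcases eq_add_sub_or a b with h' | h'
    · exact ⟨_, h'⟩
    · exact ⟨0, by rw [h', h]; simp⟩
  · rintro ⟨c, rfl⟩
    rw [sub_add', sub_self', zero_sub']

theorem add_right_cancel' {a b c : M.C T0} (h : a + c = b + c) : a = b := by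
  rw [← add_sub_cancel' a c, h, add_sub_cancel']

theorem add_eq_zero_left {a b : M.C T0} (h : a + b = 0) : a = 0 := by
  rcases eq_zero_or_eq_S a with h' | ⟨j, rfl⟩
  · exact h'
  · rw [S_add] at h
    exact (S_ne_zero _ h).elim

noncomputable instance : LinearOrder (M.C T0) where
  le_refl a := sub_self' a
  le_trans a b c h h' := by
    obtain ⟨d, rfl⟩ := le_iff_exists_add'.1 h
    obtain ⟨e, rfl⟩ := le_iff_exists_add'.1 h'
    exact le_iff_exists_add'.2 ⟨d + e, add_assoc _ _ _⟩
  le_antisymm a b h h' := by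
    obtain ⟨d, rfl⟩ := le_iff_exists_add'.1 h
    obtain ⟨e, h⟩ := le_iff_exists_add'.1 h'
    have : d + e + a = 0 + a := by 
      rw [zero_add]
      conv_rhs => rw [h]
      ring
    rw [add_eq_zero_left (add_right_cancel' this), add_zero]
  le_total a b := (eq_add_sub_or a b).imp (fun h => le_iff_exists_add'.2 ⟨_, h⟩)
    fun h => le_iff_exists_add'.2 ⟨_, h⟩
  toDecidableLE := Classical.decRel _

instance : IsOrderedCancelAddMonoid (M.C T0) where
  add_le_add_left a b h c := by
    obtain ⟨d, rfl⟩ := le_iff_exists_add'.1 h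
    exact le_iff_exists_add'.2 ⟨d, by ring⟩
  le_of_add_le_add_left a b c h := by
    obtain ⟨d, h⟩ := le_iff_exists_add'.1 h
    exact le_iff_exists_add'.2 ⟨d, add_right_cancel' (c := a) (by rw [add_comm, h]; ring)⟩

instance : CanonicallyOrderedAdd (M.C T0) where
  exists_add_of_le h := le_iff_exists_add'.1 h
  le_add_self _ b := le_iff_exists_add'.2 ⟨b, add_comm _ _⟩
  le_self_add _ b := le_iff_exists_add'.2 ⟨b, rfl⟩

instance : Nontrivial (M.C T0) := ⟨⟨1, 0, S_ne_zero 0⟩⟩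

instance : OrderedSub (M.C T0) where
  tsub_le_iff_right a b c := by
    rw [le_def, le_def, ← sub_add', add_comm]

theorem mul_pos' {a b : M.C T0} (ha : 0 < a) (hb : 0 < b) : 0 < a * b := by
  rcases eq_zero_or_eq_S a with rfl | ⟨a, rfl⟩
  · exact (lt_irrefl _ ha).elim
  rcases eq_zero_or_eq_S b with rfl | ⟨b, rfl⟩
  · exact (lt_irrefl _ hb).elim
  rw [mul_S, add_S]
  exact pos_iff_ne_zero.2 (S_ne_zero _)

instance : IsStrictOrderedRing (M.C T0) where
  zero_le_one := zero_le
  mul_lt_mul_of_pos_left _ ha b c h := by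
    obtain ⟨d, rfl⟩ := le_iff_exists_add'.1 h.le
    have hd : 0 < d := pos_iff_ne_zero.2 fun hd => by simp [hd] at h
    simpa [mul_add] using mul_pos' ha hd
  mul_lt_mul_of_pos_right _ ha b c h := by
    obtain ⟨d, rfl⟩ := le_iff_exists_add'.1 h.le
    have hd : 0 < d := pos_iff_ne_zero.2 fun hd => by simp [hd] at h
    simpa [add_mul] using mul_pos' hd ha

theorem lt_iff_add_one_le' {a b : M.C T0} : a < b ↔ a + 1 ≤ b := by
  constructor
  · intro h
    obtain ⟨d, rfl⟩ := le_iff_exists_add'.1 h.le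
    rcases eq_zero_or_eq_S d with rfl | ⟨d, rfl⟩
    · simp at h
    · exact le_iff_exists_add'.2 ⟨d, by rw [S_eq]; ring⟩
  · exact fun h => lt_of_lt_of_le (by simp) h

end Model

end HORM

namespace HORM

namespace Model

variable {M : Model} {Γ : List FType} {X : Type} [Ctx M X]

/-! ### Values of the arithmetical terms -/

section EvalArith

variable {ν : M.Val} {ρ : M.Env Γ} {s t : Tm Γ T0}

@[simp] theorem eval_sc : eval ν ρ (sc t) = eval ν ρ t + 1 := S_eq _

@[simp] theorem eval_one : eval ν ρ one = 1 := rfl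

@[simp] theorem eval_two : eval ν ρ two = 2 := by
  simp only [two, eval_sc, eval_one, one_add_one_eq_two]

@[simp] theorem eval_add : eval ν ρ (add s t) = eval ν ρ s + eval ν ρ t := by
  simp [add, add_def, sc]

@[simp] theorem eval_pred : eval ν ρ (pred t) = prd (eval ν ρ t) := by
  simp [pred, prd]

@[simp] theorem eval_mul : eval ν ρ (mul s t) = eval ν ρ s * eval ν ρ t := by
  simp [mul, mul_def]

@[simp] theorem eval_monus : eval ν ρ (monus s t) = eval ν ρ s - eval ν ρ t := by
  simp [monus, sub_def]

@[simp] theorem sat_leN : Sat ν ρ (leN s t) ↔ eval ν ρ s ≤ eval ν ρ t := by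
  simp [leN, le_def]

@[simp] theorem sat_ltN : Sat ν ρ (ltN s t) ↔ eval ν ρ s < eval ν ρ t := by
  simp [ltN, lt_iff_add_one_le']

end EvalArith

@[simp] theorem prd_add_one (n : M.C T0) : prd (n + 1) = n := by rw [← S_eq, prd_S]

theorem prd_add_one_of_pos {n : M.C T0} (h : 0 < n) : prd n + 1 = n := by
  rcases eq_zero_or_eq_S n with rfl | ⟨m, rfl⟩
  · exact (lt_irrefl _ h).elim
  · rw [prd_S, S_eq]

theorem lt_add_one_iff' {a b : M.C T0} : a < b + 1 ↔ a ≤ b := by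
  rw [lt_iff_add_one_le', add_le_add_iff_right]

@[simp] theorem natrec_add_one {b : M.C T0} {f : M.C T0 → M.C T0 → M.C T0}
    [h : IsDef fun p : (M.Pt × M.C T0) × M.C T0 => f p.1.2 p.2] (n : M.C T0) :
    natrec (n + 1) b f = f (natrec n b f) n := by
  rw [← S_eq, natrec_S]

/-! ## Definable predicates -/

/-- Definability of a predicate. -/
class IsDefP (P : X → Prop) : Prop where
  out : ∃ f : X → M.C T0, IsDef f ∧ ∀ x, P x ↔ f x = 0

theorem IsDefP.of_iff {P : X → Prop} (f : X → M.C T0) [IsDef f] (h : ∀ x, P x ↔ f x = 0) :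
    IsDefP P := ⟨f, inferInstance, h⟩

/-- A proposition independent of the arguments is true or false in the metatheory, so a constant
serves as its characteristic function. -/
instance (p : Prop) : IsDefP fun _ : X => p := by
  by_cases h : p
  · exact .of_iff (fun _ => 0) fun _ => iff_of_true h rfl
  · exact .of_iff (fun _ => 1) fun _ => iff_of_false h one_ne_zero

instance {f g : X → M.C T0} [IsDef f] [IsDef g] : IsDefP fun x => f x ≤ g x :=
  .of_iff (fun x => f x - g x) fun _ => Iff.rfl

theorem IsDefP.congr {P Q : X → Prop} (h : IsDefP P) (hPQ : ∀ x, Q x ↔ P x) : IsDefP Q := by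
  rwa [show Q = P from funext fun x => propext (hPQ x)]

theorem one_sub_eq_zero_iff {n : M.C T0} : 1 - n = 0 ↔ n ≠ 0 := by
  rw [← le_def, ← zero_add (1 : M.C T0), ← lt_iff_add_one_le', pos_iff_ne_zero]

instance {P : X → Prop} [h : IsDefP P] : IsDefP fun x => ¬ P x := by
  obtain ⟨f, hf, h⟩ := h.out
  exact .of_iff (fun x => 1 - f x) fun x => by rw [h, one_sub_eq_zero_iff]

instance {P Q : X → Prop} [h : IsDefP P] [h' : IsDefP Q] : IsDefP fun x => P x ∧ Q x := by
  obtain ⟨f, hf, h⟩ := h.out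
  obtain ⟨g, hg, h'⟩ := h'.out
  exact .of_iff (fun x => f x + g x) fun x => by rw [h, h', add_eq_zero]

instance {P Q : X → Prop} [IsDefP P] [IsDefP Q] : IsDefP fun x => P x → Q x :=
  (inferInstance : IsDefP fun x => ¬ (P x ∧ ¬ Q x)).congr fun x => by tauto

instance {f g : X → M.C T0} [IsDef f] [IsDef g] : IsDefP fun x => f x < g x :=
  (inferInstance : IsDefP fun x => ¬ (g x ≤ f x)).congr fun _ => not_le.symm

instance {f g : X → M.C T0} [IsDef f] [IsDef g] : IsDefP fun x => f x = g x :=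
  (inferInstance : IsDefP fun x => f x ≤ g x ∧ g x ≤ f x).congr fun _ => le_antisymm_iff

instance {P : X → Prop} [h : IsDefP P] [∀ x, Decidable (P x)] {f g : X → M.C T0} [IsDef f]
    [IsDef g] : IsDef fun x => if P x then f x else g x := by
  obtain ⟨c, hc, h⟩ := h.out
  -- The number c may be any nonzero value when P fails; 1 - c and 1 - (1 - c) normalize it to
  -- complementary 0-1 weights.
  have : (fun x => if P x then f x else g x) =
      fun x => (1 - c x) * f x + (1 - (1 - c x)) * g x := by
    funext x
    by_cases hx : P x
    · simp [hx, (h x).1 hx]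
    · have := one_sub_eq_zero_iff.2 (mt (h x).2 hx)
      simp [hx, this]
  rw [this]
  infer_instance

theorem induction_on' {P : M.C T0 → Prop} (h : IsDefP fun p : M.Pt × M.C T0 => P p.2)
    (h0 : P 0) (hs : ∀ n, P n → P (n + 1)) (n : M.C T0) : P n := by
  obtain ⟨f, hf, h⟩ := h.out
  have hf' (n) : P n ↔ f (.pt, n) = 0 := h (.pt, n)
  obtain ⟨G, -, hG⟩ := hf.out
  have : IsDef fun p : M.Pt × M.C T0 => f (.pt, p.2) := ⟨_, Ctx.const (G .pt), fun _ y => hG _ y⟩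
  refine (hf' n).2 (eq_induction (f := fun n => f (.pt, n)) (g := fun _ => 0) ((hf' 0).1 h0)
    (fun n hn => ?_) n)
  rw [S_eq]
  exact (hf' _).1 (hs n ((hf' n).2 hn))

/-- The functional `∃²` exists. -/
class HasE2 (M : Model) : Prop where
  out : ∃ φ : M.C T2, ∀ f : M.C T1, (∃ n, f ⊙ n = 0) ↔ φ ⊙ f = 0

section HasE2

variable [HasE2 M]

/-- Arithmetical comprehension: apply `∃²` to the curried characteristic function. -/
instance {P : X → M.C T0 → Prop} [h : IsDefP fun p : X × M.C T0 => P p.1 p.2] :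
    IsDefP fun x => ∃ n, P x n := by
  obtain ⟨f, hf, h⟩ := h.out
  obtain ⟨φ, hφ⟩ := HasE2.out (M := M)
  obtain ⟨G, hG, hfG⟩ := hf.out
  have : IsDef G := ⟨hG⟩
  refine .of_iff (fun x => φ ⊙ G x) fun x => ?_
  rw [← hφ]
  exact exists_congr fun n => (h (x, n)).trans (by rw [hfG])

instance {P : X → M.C T0 → Prop} [IsDefP fun p : X × M.C T0 => P p.1 p.2] :
    IsDefP fun x => ∀ n, P x n :=
  (inferInstance : IsDefP fun x => ¬ ∃ n, ¬ P x n).congr fun x => by simp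

/-- A functional that finds zeros. -/
theorem exists_search : ∃ F : M.C T2, ∀ f : M.C T1, (∃ n, f ⊙ n = 0) → f ⊙ (F ⊙ f) = 0 := by
  classical
  -- Choice needs a zero for every f; functions without one are therefore replaced by the constant
  -- 0.
  let A : M.C (T1 ⇒ T0 ⇒ T0) :=
    lam fun f => lam fun n => if ∃ m, f ⊙ m = 0 then f ⊙ n else 0
  have hA (f n) : A ⊙ f ⊙ n = if ∃ m, f ⊙ m = 0 then f ⊙ n else 0 := by
    simp only [A, lam_ap]
  obtain ⟨F, hF⟩ := M.choice A fun f => by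
    change ∃ n, A ⊙ f ⊙ n = 0
    by_cases h : ∃ m, f ⊙ m = 0
    · obtain ⟨n, hn⟩ := h
      exact ⟨n, by rw [hA, hn, ite_self]⟩
    · exact ⟨0, by rw [hA, if_neg h]⟩
  refine ⟨F, fun f hf => ?_⟩
  have : A ⊙ f ⊙ (F ⊙ f) = 0 := hF f
  rwa [hA, if_pos hf] at this

end HasE2

/-! ## Pairing and powers of two -/

noncomputable def nTri (n : M.C T0) : M.C T0 := natrec n 0 fun u v => u + (v + 1)

instance {f : X → M.C T0} [IsDef f] : IsDef fun x => nTri (f x) := by unfold nTri; infer_instance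

noncomputable def nEq (m n : M.C T0) : M.C T0 := 1 - ((m - n) + (n - m))

instance {f g : X → M.C T0} [IsDef f] [IsDef g] : IsDef fun x => nEq (f x) (g x) := by
  unfold nEq; infer_instance

noncomputable def nDiag (n : M.C T0) : M.C T0 := natrec n 0 fun u v => u + nEq (nTri (u + 1)) (v + 1)

instance {f : X → M.C T0} [IsDef f] : IsDef fun x => nDiag (f x) := by
  unfold nDiag; infer_instance

noncomputable def nPair (m n : M.C T0) : M.C T0 := nTri (m + n) + m

instance {f g : X → M.C T0} [IsDef f] [IsDef g] : IsDef fun x => nPair (f x) (g x) := by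
  unfold nPair; infer_instance

noncomputable def nFst (n : M.C T0) : M.C T0 := n - nTri (nDiag n)

instance {f : X → M.C T0} [IsDef f] : IsDef fun x => nFst (f x) := by
  unfold nFst; infer_instance

noncomputable def nSnd (n : M.C T0) : M.C T0 := nDiag n - nFst n

instance {f : X → M.C T0} [IsDef f] : IsDef fun x => nSnd (f x) := by
  unfold nSnd; infer_instance

noncomputable def nPow (n : M.C T0) : M.C T0 := natrec n 1 fun u _ => u + u

instance {f : X → M.C T0} [IsDef f] : IsDef fun x => nPow (f x) := by
  unfold nPow; infer_instance

@[simp] theorem nTri_zero : nTri (0 : M.C T0) = 0 := natrec_zero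

@[simp] theorem nTri_add_one (n : M.C T0) : nTri (n + 1) = nTri n + (n + 1) := natrec_add_one n

theorem nEq_self (n : M.C T0) : nEq n n = 1 := by simp [nEq]

theorem nEq_of_ne {m n : M.C T0} (h : m ≠ n) : nEq m n = 0 := by
  rw [nEq, one_sub_eq_zero_iff, ne_eq, add_eq_zero]
  exact fun h' => h (le_antisymm h'.1 h'.2)

@[simp] theorem nDiag_zero : nDiag (0 : M.C T0) = 0 := natrec_zero

@[simp] theorem nDiag_add_one (n : M.C T0) :
    nDiag (n + 1) = nDiag n + nEq (nTri (nDiag n + 1)) (n + 1) := natrec_add_one n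

theorem nTri_le_add (m k : M.C T0) : nTri m ≤ nTri (m + k) := by
  induction k using induction_on' with
  | h => infer_instance
  | h0 => simp
  | hs k ih =>
    rw [← add_assoc, nTri_add_one]
    exact ih.trans le_self_add

theorem nTri_mono {m n : M.C T0} (h : m ≤ n) : nTri m ≤ nTri n := by
  obtain ⟨k, rfl⟩ := le_iff_exists_add'.1 h
  exact nTri_le_add m k

/-- The counter increases exactly when the next triangular number is reached, which keeps n between
consecutive triangular numbers. -/
theorem nDiag_spec (n : M.C T0) : nTri (nDiag n) ≤ n ∧ n < nTri (nDiag n + 1) := by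
  induction n using induction_on' with
  | h => infer_instance
  | h0 =>
    have := nTri_add_one (0 : M.C T0)
    rw [zero_add] at this
    simp [this]
  | hs n ih =>
    obtain ⟨h1, h2⟩ := ih
    rw [nDiag_add_one]
    by_cases h : nTri (nDiag n + 1) = n + 1
    · rw [h, nEq_self, nTri_add_one (nDiag n + 1), h]
      exact ⟨le_rfl, by simp⟩
    · rw [nEq_of_ne h, add_zero]
      exact ⟨h1.trans le_self_add, lt_of_le_of_ne (lt_iff_add_one_le'.1 h2) (Ne.symm h)⟩

theorem nDiag_nPair (m n : M.C T0) : nDiag (nPair m n) = m + n := by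
  obtain ⟨h1, h2⟩ := nDiag_spec (nPair m n)
  have h3 : nTri (m + n) ≤ nPair m n := le_self_add
  have h4 : nPair m n < nTri (m + n + 1) := by
    rw [nTri_add_one, nPair, add_lt_add_iff_left, lt_add_one_iff']
    exact le_self_add
  apply le_antisymm
  · by_contra! h
    exact absurd (h4.trans_le (nTri_mono (lt_iff_add_one_le'.1 h))) (not_lt.2 h1)
  · by_contra! h
    exact absurd (h2.trans_le (nTri_mono (lt_iff_add_one_le'.1 h))) (not_lt.2 h3)

@[simp] theorem nFst_nPair (m n : M.C T0) : nFst (nPair m n) = m := by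
  rw [nFst, nDiag_nPair, nPair, add_tsub_cancel_left]

@[simp] theorem nSnd_nPair (m n : M.C T0) : nSnd (nPair m n) = n := by
  rw [nSnd, nDiag_nPair, nFst_nPair, add_tsub_cancel_left]

@[simp] theorem nPow_zero : nPow (0 : M.C T0) = 1 := natrec_zero

@[simp] theorem nPow_add_one (n : M.C T0) : nPow (n + 1) = nPow n + nPow n := natrec_add_one n

theorem nPow_add (m n : M.C T0) : nPow (m + n) = nPow m * nPow n := by
  induction n using induction_on' with
  | h => infer_instance
  | h0 => simp
  | hs n ih => rw [← add_assoc, nPow_add_one, ih, nPow_add_one]; ring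

/-- The source of the Archimedean property `exists_eps_lt`. -/
theorem lt_nPow (n : M.C T0) : n < nPow n := by
  induction n using induction_on' with
  | h => infer_instance
  | h0 => simp
  | hs n ih =>
    rw [nPow_add_one]
    exact add_lt_add_of_lt_of_le ih (lt_iff_add_one_le'.1 (zero_le.trans_lt ih) |>.trans' (by simp))

theorem nPow_pos (n : M.C T0) : 0 < nPow n := zero_le.trans_lt (lt_nPow n)

section EvalPair

variable {ν : M.Val} {ρ : M.Env Γ} {s t : Tm Γ T0}

@[simp] theorem eval_tri : eval ν ρ (tri t) = nTri (eval ν ρ t) := by simp [tri, nTri]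

@[simp] theorem eval_eqInd : eval ν ρ (eqInd s t) = nEq (eval ν ρ s) (eval ν ρ t) := by
  simp [eqInd, nEq]

@[simp] theorem eval_diag : eval ν ρ (diag t) = nDiag (eval ν ρ t) := by simp [diag, nDiag]

@[simp] theorem eval_pair : eval ν ρ (pair s t) = nPair (eval ν ρ s) (eval ν ρ t) := by
  simp [pair, nPair]

@[simp] theorem eval_fst : eval ν ρ (fst t) = nFst (eval ν ρ t) := by simp [fst, nFst]

@[simp] theorem eval_snd : eval ν ρ (snd t) = nSnd (eval ν ρ t) := by simp [snd, nSnd]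

@[simp] theorem eval_pow2 : eval ν ρ (pow2 t) = nPow (eval ν ρ t) := by simp [pow2, nPow]

end EvalPair

end Model

end HORM

namespace HORM

/-! ## The ordered field of fractions of an ordered semiring -/

section Differences

variable (R : Type) [CommSemiring R] [IsCancelAdd R]

/-- Formal differences of elements of a cancellative semiring. -/
def diffSetoid : Setoid (R × R) where
  r p q := p.1 + q.2 = q.1 + p.2
  iseqv := by
    refine ⟨fun _ => rfl, fun h => h.symm, fun {p q r} h h' => ?_⟩
    apply add_right_cancel (b := q.1 + q.2)
    calc p.1 + r.2 + (q.1 + q.2) = (p.1 + q.2) + (q.1 + r.2) := by ring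
      _ = (q.1 + p.2) + (r.1 + q.2) := by rw [h, h']
      _ = _ := by ring

def Diff : Type := Quotient (diffSetoid R)

namespace Diff

variable {R}

def mk (a b : R) : Diff R := Quotient.mk (diffSetoid R) (a, b)

theorem mk_eq {a b c d : R} : mk a b = mk c d ↔ a + d = c + b :=
  ⟨fun h => Quotient.exact h, fun h => Quotient.sound h⟩

theorem exists_mk (x : Diff R) : ∃ a b, x = mk a b :=
  ⟨x.out.1, x.out.2, (Quotient.out_eq x).symm⟩

instance : Add (Diff R) := ⟨Quotient.map₂ (fun p q => (p.1 + q.1, p.2 + q.2)) fun p p' h q q' h' =>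
  show p.1 + q.1 + (p'.2 + q'.2) = p'.1 + q'.1 + (p.2 + q.2) by
    have h : p.1 + p'.2 = p'.1 + p.2 := h
    have h' : q.1 + q'.2 = q'.1 + q.2 := h'
    calc p.1 + q.1 + (p'.2 + q'.2) = (p.1 + p'.2) + (q.1 + q'.2) := by ring
      _ = _ := by rw [h, h']; ring⟩

instance : Mul (Diff R) := ⟨Quotient.map₂ (fun p q => (p.1 * q.1 + p.2 * q.2,
    p.1 * q.2 + p.2 * q.1)) fun p p' h q q' h' =>
  show p.1 * q.1 + p.2 * q.2 + (p'.1 * q'.2 + p'.2 * q'.1) =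
      p'.1 * q'.1 + p'.2 * q'.2 + (p.1 * q.2 + p.2 * q.1) by
    have h : p.1 + p'.2 = p'.1 + p.2 := h
    have h' : q.1 + q'.2 = q'.1 + q.2 := h'
    apply add_right_cancel (b := p'.2 * q.1 + p'.1 * q.2)
    calc _ = (p.1 + p'.2) * q.1 + p.2 * q.2 + p'.1 * (q.2 + q'.2) + p'.2 * q'.1 := by ring
      _ = p'.1 * (q.1 + q'.2) + p.2 * q.1 + (p.2 + p'.1) * q.2 + p'.2 * q'.1 := by rw [h]; ring
      _ = p'.1 * q'.1 + p.2 * q.1 + (p'.1 + p.2) * q.2 + p'.2 * q'.1 + p'.1 * q.2 := by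
        rw [h']; ring
      _ = p'.1 * q'.1 + p.2 * q.1 + p.1 * q.2 + p'.2 * (q'.1 + q.2) + p'.1 * q.2 := by
        rw [← h]; ring
      _ = _ := by rw [← h']; ring⟩

instance : Neg (Diff R) := ⟨Quotient.map (fun p => (p.2, p.1)) fun p p' h =>
  show p.2 + p'.1 = p'.2 + p.1 by
    have h : p.1 + p'.2 = p'.1 + p.2 := h
    rw [add_comm, ← h, add_comm]⟩

instance : Zero (Diff R) := ⟨mk 0 0⟩
instance : One (Diff R) := ⟨mk 1 0⟩

theorem mk_add (a b c d : R) : mk a b + mk c d = mk (a + c) (b + d) := rfl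
theorem mk_mul (a b c d : R) : mk a b * mk c d = mk (a * c + b * d) (a * d + b * c) := rfl
theorem neg_mk (a b : R) : -mk a b = mk b a := rfl
theorem zero_def : (0 : Diff R) = mk 0 0 := rfl
theorem one_def : (1 : Diff R) = mk 1 0 := rfl

theorem add_comm' (x y : Diff R) : x + y = y + x := by
  obtain ⟨a, b, rfl⟩ := x.exists_mk
  obtain ⟨c, d, rfl⟩ := y.exists_mk
  rw [mk_add, mk_add, add_comm a, add_comm b]

theorem mul_comm' (x y : Diff R) : x * y = y * x := by
  obtain ⟨a, b, rfl⟩ := x.exists_mk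
  obtain ⟨c, d, rfl⟩ := y.exists_mk
  rw [mk_mul, mk_mul, mk_eq]
  ring

theorem mul_add' (x y z : Diff R) : x * (y + z) = x * y + x * z := by
  obtain ⟨a, b, rfl⟩ := x.exists_mk
  obtain ⟨c, d, rfl⟩ := y.exists_mk
  obtain ⟨e, f, rfl⟩ := z.exists_mk
  simp only [mk_mul, mk_add, mk_eq]
  ring

theorem zero_add' (x : Diff R) : 0 + x = x := by
  obtain ⟨a, b, rfl⟩ := x.exists_mk
  rw [zero_def, mk_add, zero_add, zero_add]

theorem one_mul' (x : Diff R) : 1 * x = x := by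
  obtain ⟨a, b, rfl⟩ := x.exists_mk
  rw [one_def, mk_mul, mk_eq]
  ring

theorem zero_mul' (x : Diff R) : 0 * x = 0 := by
  obtain ⟨a, b, rfl⟩ := x.exists_mk
  rw [zero_def, mk_mul, mk_eq]
  ring

instance : CommRing (Diff R) where
  add_assoc x y z := by
    obtain ⟨a, b, rfl⟩ := x.exists_mk
    obtain ⟨c, d, rfl⟩ := y.exists_mk
    obtain ⟨e, f, rfl⟩ := z.exists_mk
    simp only [mk_add, add_assoc]
  zero_add := zero_add'
  add_zero x := by rw [add_comm', zero_add']
  add_comm := add_comm'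
  left_distrib := mul_add'
  right_distrib x y z := by rw [mul_comm', mul_add', mul_comm' z, mul_comm' z]
  zero_mul := zero_mul'
  mul_zero x := by rw [mul_comm', zero_mul']
  mul_assoc x y z := by
    obtain ⟨a, b, rfl⟩ := x.exists_mk
    obtain ⟨c, d, rfl⟩ := y.exists_mk
    obtain ⟨e, f, rfl⟩ := z.exists_mk
    simp only [mk_mul, mk_eq]
    ring
  one_mul := one_mul'
  mul_one x := by rw [mul_comm', one_mul']
  neg_add_cancel x := by
    obtain ⟨a, b, rfl⟩ := x.exists_mk
    rw [neg_mk, mk_add, zero_def, mk_eq]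
    ring
  mul_comm := mul_comm'
  nsmul := nsmulRec
  zsmul := zsmulRec

/-- The embedding of the semiring. -/
def of : R →+* Diff R where
  toFun a := mk a 0
  map_zero' := rfl
  map_one' := rfl
  map_add' a b := by rw [mk_add, add_zero]
  map_mul' a b := by
    rw [mk_mul, mk_eq]
    ring

theorem of_injective : Function.Injective (of (R := R)) := fun a b h => by
  simpa using mk_eq.1 h

theorem mk_eq_of (a b : R) : mk a b = of a - of b := by
  change _ = mk a 0 - mk b 0
  rw [sub_eq_add_neg, neg_mk, mk_add, zero_add, add_zero]

end Diff

end Differences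

/-! ### The ordered field of fractions of differences -/

section Fractions

variable (R : Type) [CommSemiring R] [LinearOrder R] [IsStrictOrderedRing R]
  [CanonicallyOrderedAdd R]

theorem Diff.eq_or_eq_neg (x : Diff R) : ∃ a : R, x = of a ∨ x = -of a := by
  obtain ⟨a, b, rfl⟩ := x.exists_mk
  rw [mk_eq_of]
  rcases le_total a b with h | h
  · obtain ⟨c, rfl⟩ := exists_add_of_le h
    exact ⟨c, .inr (by rw [map_add]; ring)⟩
  · obtain ⟨c, rfl⟩ := exists_add_of_le h
    exact ⟨c, .inl (by rw [map_add]; ring)⟩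

instance : Nontrivial (Diff R) := Diff.of_injective.nontrivial

/-- Up to sign both factors come from the semiring, which has no zero divisors. -/
instance : IsDomain (Diff R) := by
  have : NoZeroDivisors (Diff R) := by
    refine ⟨fun {x y} h => ?_⟩
    obtain ⟨a, ha⟩ := Diff.eq_or_eq_neg R x
    obtain ⟨b, hb⟩ := Diff.eq_or_eq_neg R y
    have hab : Diff.of (a * b) = 0 := by
      rw [map_mul]
      rcases ha with rfl | rfl <;> rcases hb with rfl | rfl <;> simpa using h
    rw [map_eq_zero_iff _ Diff.of_injective, mul_eq_zero] at hab
    refine hab.imp ?_ ?_ <;> rintro rfl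
    · rcases ha with rfl | rfl <;> simp
    · rcases hb with rfl | rfl <;> simp
  exact NoZeroDivisors.to_isDomain _

/-- The field of fractions of differences. -/
abbrev Frac : Type := FractionRing (Diff R)

namespace Frac

variable {R}

/-- The embedding of the semiring. -/
noncomputable def of : R →+* Frac R := (algebraMap (Diff R) (Frac R)).comp Diff.of

omit [CanonicallyOrderedAdd R] in
theorem of_injective : Function.Injective (of (R := R)) :=
  (IsFractionRing.injective (Diff R) (Frac R)).comp Diff.of_injective

omit [CanonicallyOrderedAdd R] in
theorem of_ne_zero {a : R} (h : a ≠ 0) : of a ≠ 0 := (map_ne_zero_iff _ of_injective).2 h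

theorem eq_or_eq_neg (x : Frac R) : ∃ a b : R, b ≠ 0 ∧ (x = of a / of b ∨ x = -(of a / of b)) := by
  obtain ⟨z, w, hw, rfl⟩ := IsFractionRing.div_surjective (A := Diff R) x
  obtain ⟨a, ha⟩ := Diff.eq_or_eq_neg R z
  obtain ⟨b, hb⟩ := Diff.eq_or_eq_neg R w
  refine ⟨a, b, ?_, ?_⟩
  · rintro rfl
    refine nonZeroDivisors.ne_zero hw ?_
    rcases hb with rfl | rfl <;> simp
  · rcases ha with rfl | rfl <;> rcases hb with rfl | rfl <;> simp [of, neg_div, div_neg]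

/-- The cone of nonnegative fractions. -/
def cone : RingCone (Frac R) where
  carrier := {x | ∃ a b : R, b ≠ 0 ∧ x = of a / of b}
  zero_mem' := ⟨0, 1, one_ne_zero, by simp⟩
  one_mem' := ⟨1, 1, one_ne_zero, by simp⟩
  add_mem' := by
    rintro _ _ ⟨a, b, hb, rfl⟩ ⟨c, d, hd, rfl⟩
    refine ⟨a * d + b * c, b * d, mul_ne_zero hb hd, ?_⟩
    rw [div_add_div _ _ (of_ne_zero hb) (of_ne_zero hd)]
    simp
  mul_mem' := by
    rintro _ _ ⟨a, b, hb, rfl⟩ ⟨c, d, hd, rfl⟩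
    refine ⟨a * c, b * d, mul_ne_zero hb hd, ?_⟩
    rw [div_mul_div_comm]
    simp
  eq_zero_of_mem_of_neg_mem' := by
    rintro _ ⟨a, b, hb, rfl⟩ ⟨c, d, hd, h⟩
    have hb' := of_ne_zero hb
    have hd' := of_ne_zero hd
    field_simp at h
    -- Clearing denominators in -(a/b) = c/d gives ad + bc = 0 in the semiring; in a canonically
    -- ordered semiring both summands vanish.
    have h : of (a * d + b * c) = 0 := by
      rw [map_add, map_mul, map_mul]
      linear_combination -h
    rw [map_eq_zero_iff _ of_injective, add_eq_zero, mul_eq_zero] at h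
    simp [h.1.resolve_right hd]

instance : HasMemOrNegMem (cone (R := R)) where
  mem_or_neg_mem x := by
    obtain ⟨a, b, hb, h | h⟩ := eq_or_eq_neg x
    · exact .inl ⟨a, b, hb, h⟩
    · exact .inr ⟨a, b, hb, by rw [h, neg_neg]⟩

variable (R) in
theorem exists_linearOrder : ∃ _ : LinearOrder (Frac R), IsStrictOrderedRing (Frac R) ∧
    ∀ x : Frac R, 0 ≤ x ↔ ∃ a b : R, b ≠ 0 ∧ x = of a / of b := by
  have : DecidablePred (· ∈ cone (R := R)) := Classical.decPred _
  let _ : LinearOrder (Frac R) := LinearOrder.mkOfAddGroupCone cone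
  have : IsOrderedRing (Frac R) := IsOrderedRing.mkOfCone cone
  refine ⟨inferInstance, IsOrderedRing.toIsStrictOrderedRing _, fun x => ?_⟩
  change x - 0 ∈ cone ↔ _
  rw [sub_zero]
  rfl

noncomputable instance : LinearOrder (Frac R) := (exists_linearOrder R).choose

instance : IsStrictOrderedRing (Frac R) := (exists_linearOrder R).choose_spec.1

theorem nonneg_iff {x : Frac R} : 0 ≤ x ↔ ∃ a b : R, b ≠ 0 ∧ x = of a / of b :=
  (exists_linearOrder R).choose_spec.2 x

theorem of_nonneg (a : R) : 0 ≤ of a := nonneg_iff.2 ⟨a, 1, one_ne_zero, by simp⟩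

theorem of_strictMono : StrictMono (of (R := R)) := by
  intro a b h
  obtain ⟨c, rfl⟩ := exists_add_of_le h.le
  have hc : c ≠ 0 := by
    rintro rfl
    simp at h
  rw [map_add, lt_add_iff_pos_right]
  exact lt_of_le_of_ne (of_nonneg c) (of_ne_zero hc).symm

@[simp] theorem of_le_of {a b : R} : of a ≤ of b ↔ a ≤ b := of_strictMono.le_iff_le

@[simp] theorem of_lt_of {a b : R} : of a < of b ↔ a < b := of_strictMono.lt_iff_lt

end Frac

end Fractions

end HORM

namespace HORM

namespace Model

variable {M : Model} {Γ : List FType} {X : Type} [Ctx M X]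

/-! ## Rational numbers in a model -/

open Frac (of)

/-- The value of a code of a rational number. -/
noncomputable def qv (q : M.C T0) : Frac (M.C T0) :=
  (of (nFst q) - of (nFst (nSnd q))) / of (nSnd (nSnd q) + 1)

/-- `2^{-k}`. -/
noncomputable def eps (k : M.C T0) : Frac (M.C T0) := 1 / of (nPow k)

noncomputable def nQ (a b c : M.C T0) : M.C T0 := nPair a (nPair b c)

instance {f g h : X → M.C T0} [IsDef f] [IsDef g] [IsDef h] :
    IsDef fun x => nQ (f x) (g x) (h x) := by
  unfold nQ; infer_instance

noncomputable def nQDen (q : M.C T0) : M.C T0 := nSnd (nSnd q) + 1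

instance {f : X → M.C T0} [IsDef f] : IsDef fun x => nQDen (f x) := by
  unfold nQDen; infer_instance

noncomputable def nQAdd (p q : M.C T0) : M.C T0 :=
  nQ (nFst p * nQDen q + nFst q * nQDen p) (nFst (nSnd p) * nQDen q + nFst (nSnd q) * nQDen p)
    (prd (nQDen p * nQDen q))

instance {f g : X → M.C T0} [IsDef f] [IsDef g] : IsDef fun x => nQAdd (f x) (g x) := by
  unfold nQAdd; infer_instance

noncomputable def nQSub (p q : M.C T0) : M.C T0 :=
  nQ (nFst p * nQDen q + nFst (nSnd q) * nQDen p) (nFst (nSnd p) * nQDen q + nFst q * nQDen p)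
    (prd (nQDen p * nQDen q))

instance {f g : X → M.C T0} [IsDef f] [IsDef g] : IsDef fun x => nQSub (f x) (g x) := by
  unfold nQSub; infer_instance

noncomputable def nQAbs (p : M.C T0) : M.C T0 :=
  nQ ((nFst p - nFst (nSnd p)) + (nFst (nSnd p) - nFst p)) 0 (prd (nQDen p))

instance {f : X → M.C T0} [IsDef f] : IsDef fun x => nQAbs (f x) := by
  unfold nQAbs; infer_instance

noncomputable def nDyadic (m k : M.C T0) : M.C T0 := nQ m 0 (prd (nPow k))

instance {f g : X → M.C T0} [IsDef f] [IsDef g] : IsDef fun x => nDyadic (f x) (g x) := by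
  unfold nDyadic; infer_instance

theorem nQDen_pos (q : M.C T0) : 0 < nQDen q := zero_le.trans_lt (lt_add_one_iff'.2 le_rfl)

theorem of_pos {a : M.C T0} (h : 0 < a) : 0 < of a := by
  rw [← map_zero (of (R := M.C T0))]
  exact Frac.of_strictMono h

theorem of_nQDen_pos (q : M.C T0) : 0 < of (nQDen q) := of_pos (nQDen_pos q)

theorem qv_eq (q : M.C T0) : qv q = (of (nFst q) - of (nFst (nSnd q))) / of (nQDen q) := rfl

theorem qv_nQ (a b c : M.C T0) : qv (nQ a b c) = (of a - of b) / of (c + 1) := by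
  simp [qv, nQ]

@[simp] theorem qv_nQAdd (p q : M.C T0) : qv (nQAdd p q) = qv p + qv q := by
  rw [nQAdd, qv_nQ, prd_add_one_of_pos (mul_pos (nQDen_pos p) (nQDen_pos q)), qv_eq, qv_eq,
    div_add_div _ _ (of_nQDen_pos p).ne' (of_nQDen_pos q).ne']
  simp only [map_add, map_mul]
  ring

@[simp] theorem qv_nQSub (p q : M.C T0) : qv (nQSub p q) = qv p - qv q := by
  rw [nQSub, qv_nQ, prd_add_one_of_pos (mul_pos (nQDen_pos p) (nQDen_pos q)), qv_eq, qv_eq,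
    div_sub_div _ _ (of_nQDen_pos p).ne' (of_nQDen_pos q).ne']
  simp only [map_add, map_mul]
  ring

@[simp] theorem qv_nQAbs (p : M.C T0) : qv (nQAbs p) = |qv p| := by
  rw [nQAbs, qv_nQ, prd_add_one_of_pos (nQDen_pos p), qv_eq, abs_div,
    abs_of_pos (of_nQDen_pos p)]
  congr 1
  rcases le_total (nFst p) (nFst (nSnd p)) with h | h
  · rw [tsub_eq_zero_of_le h, abs_of_nonpos (by simpa using h)]
    obtain ⟨c, hc⟩ := exists_add_of_le h
    simp [hc]
  · rw [tsub_eq_zero_of_le h, abs_of_nonneg (by simpa using h)]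
    obtain ⟨c, hc⟩ := exists_add_of_le h
    simp [hc]

@[simp] theorem qv_nDyadic (m k : M.C T0) : qv (nDyadic m k) = of m * eps k := by
  rw [nDyadic, qv_nQ, prd_add_one_of_pos (nPow_pos k), map_zero, sub_zero, eps, mul_one_div]

/-- Cross-multiplication without negative terms. This agrees with the formula `qLe` and makes
comparison of rationals a definable predicate of codes. -/
theorem qv_le_iff {p q : M.C T0} : qv p ≤ qv q ↔
    nFst p * nQDen q + nFst (nSnd q) * nQDen p ≤ nFst q * nQDen p + nFst (nSnd p) * nQDen q := by
  rw [qv_eq, qv_eq, div_le_div_iff₀ (of_nQDen_pos p) (of_nQDen_pos q), ← Frac.of_le_of (R := M.C T0)]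
  simp only [map_add, map_mul]
  constructor <;> intro h <;> linarith

instance {f g : X → M.C T0} [IsDef f] [IsDef g] : IsDefP fun x => qv (f x) ≤ qv (g x) := by
  simp only [qv_le_iff]; infer_instance

theorem eps_pos (k : M.C T0) : 0 < eps k := div_pos one_pos (of_pos (nPow_pos k))

@[simp] theorem eps_zero : eps (0 : M.C T0) = 1 := by simp [eps]

theorem eps_add (m k : M.C T0) : eps (m + k) = eps m * eps k := by
  rw [eps, eps, eps, nPow_add, map_mul, one_div_mul_one_div]

@[simp] theorem eps_one : eps (1 : M.C T0) = 1 / 2 := by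
  have := nPow_add_one (0 : M.C T0)
  rw [zero_add, nPow_zero, one_add_one_eq_two] at this
  rw [eps, this, map_ofNat]

theorem eps_add_one (k : M.C T0) : eps (k + 1) = eps k / 2 := by
  rw [eps_add, eps_one]; ring

theorem eps_le_one (k : M.C T0) : eps k ≤ 1 := by
  rw [eps, div_le_one (of_pos (nPow_pos k)), ← map_one (of (R := M.C T0)), Frac.of_le_of]
  exact (zero_add (1 : M.C T0)) ▸ lt_iff_add_one_le'.1 (nPow_pos k)

theorem eps_anti {k m : M.C T0} (h : k ≤ m) : eps m ≤ eps k := by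
  obtain ⟨d, rfl⟩ := exists_add_of_le h
  rw [eps_add]
  exact mul_le_of_le_one_right (eps_pos k).le (eps_le_one d)

/-- Write c = a/b with a ≥ 1; then 2^{-b} < 1/b ≤ c. The exponent b may be nonstandard, so this is
Archimedean only relative to the model. -/
theorem exists_eps_lt {c : Frac (M.C T0)} (hc : 0 < c) : ∃ k, eps k < c := by
  obtain ⟨a, b, hb, rfl⟩ := Frac.nonneg_iff.1 hc.le
  have hb' := of_pos (pos_iff_ne_zero.2 hb)
  have ha : 1 ≤ of a := by
    rw [← map_one (of (R := M.C T0)), Frac.of_le_of, ← zero_add (1 : M.C T0),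
      ← lt_iff_add_one_le', pos_iff_ne_zero]
    rintro rfl
    simp at hc
  refine ⟨b, ?_⟩
  rw [eps, div_lt_div_iff₀ (of_pos (nPow_pos b)) hb', one_mul]
  have := (Frac.of_lt_of (R := M.C T0)).2 (lt_nPow b)
  nlinarith [of_pos (nPow_pos b)]

theorem le_of_forall_eps {a b c : Frac (M.C T0)} (hc : 0 < c) (h : ∀ k, a ≤ b + c * eps k) :
    a ≤ b := by
  by_contra! hab
  obtain ⟨k, hk⟩ := exists_eps_lt (div_pos (sub_pos.2 hab) hc)
  have := h k
  rw [lt_div_iff₀ hc] at hk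
  linarith

/-! ## Real numbers in a model -/

/-- The inequalities are between values of codes, so that definability can be read off by instance
search; `isReal_iff` and its companions give the form in the field. -/
def IsReal (x : M.C T1) : Prop := ∀ k i, qv (nQAbs (nQSub (x ⊙ k) (x ⊙ (k + i)))) ≤ qv (nDyadic 1 k)

def REq (x y : M.C T1) : Prop := ∀ k, qv (nQAbs (nQSub (x ⊙ k) (y ⊙ k))) ≤ qv (nDyadic 2 k)

def RLe (x y : M.C T1) : Prop := ∀ k, qv (x ⊙ k) ≤ qv (nQAdd (y ⊙ k) (nDyadic 2 k))

/-- `|x - y| < r`. -/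
def DistLt (x y r : M.C T1) : Prop :=
  ∃ k, ¬ qv (r ⊙ k) ≤ qv (nQAdd (nQAbs (nQSub (x ⊙ (k + 1)) (y ⊙ (k + 1)))) (nDyadic 2 k))

/-- `|x - y| < 2^{-k}`. -/
def Near (x y : M.C T1) (k : M.C T0) : Prop :=
  ∃ j, ¬ qv (nDyadic 1 k) ≤ qv (nQAdd (nQAbs (nQSub (x ⊙ (j + 1)) (y ⊙ (j + 1)))) (nDyadic 2 j))

/-- `x ∈ [0,1]`. -/
def InUnit (x : M.C T1) : Prop :=
  IsReal x ∧ (∀ k, qv (nQ 0 0 0) ≤ qv (nQAdd (x ⊙ k) (nDyadic 2 k))) ∧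
    ∀ k, qv (x ⊙ k) ≤ qv (nQAdd (nQ 1 0 0) (nDyadic 2 k))

section

variable [HasE2 M] {f g : X → M.C T1}

instance {f : X → M.C T1} [hf : IsDef f] : IsDefP fun x => IsReal (f x) := by
  have := (hf.fst (σ := T0)).fst (σ := T0)
  unfold IsReal
  infer_instance

instance [hf : IsDef f] [hg : IsDef g] : IsDefP fun x => REq (f x) (g x) := by
  have := hf.fst (σ := T0)
  have := hg.fst (σ := T0)
  unfold REq
  infer_instance

instance {k : X → M.C T0} [hf : IsDef f] [hg : IsDef g] [hk : IsDef k] :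
    IsDefP fun x => Near (f x) (g x) (k x) := by
  have := hf.fst (σ := T0)
  have := hg.fst (σ := T0)
  have := hk.fst (σ := T0)
  unfold Near
  infer_instance

instance {f : X → M.C T1} [hf : IsDef f] : IsDefP fun x => InUnit (f x) := by
  have := hf.fst (σ := T0)
  unfold InUnit
  infer_instance

end

section Sat

variable {ν : M.Val} {ρ : M.Env Γ} {p q r : Tm Γ T0} {x y z : Tm Γ T1}

@[simp] theorem eval_mkQ : eval ν ρ (mkQ p q r) = nQ (eval ν ρ p) (eval ν ρ q) (eval ν ρ r) := by
  simp [mkQ, nQ]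

@[simp] theorem eval_qAdd : eval ν ρ (qAdd p q) = nQAdd (eval ν ρ p) (eval ν ρ q) := by
  simp [qAdd, nQAdd, qPos, qNeg, qDen, nQDen]

@[simp] theorem eval_qSub : eval ν ρ (qSub p q) = nQSub (eval ν ρ p) (eval ν ρ q) := by
  simp [qSub, nQSub, qPos, qNeg, qDen, nQDen]

@[simp] theorem eval_qAbs : eval ν ρ (qAbs p) = nQAbs (eval ν ρ p) := by
  simp [qAbs, nQAbs, qPos, qNeg, qDen, nQDen]

@[simp] theorem eval_qDyadic : eval ν ρ (qDyadic p q) = nDyadic (eval ν ρ p) (eval ν ρ q) := by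
  simp [qDyadic, nDyadic]

@[simp] theorem sat_qLe : Sat ν ρ (qLe p q) ↔ qv (eval ν ρ p) ≤ qv (eval ν ρ q) := by
  simp [qLe, qv_le_iff, nQDen, qPos, qNeg, qDen]

@[simp] theorem sat_isReal : Sat ν ρ (isReal x) ↔ IsReal (eval ν ρ x) := by
  simp only [isReal, IsReal, sat_allQ, sat_qLe, eval_qAbs, eval_qSub, eval_qDyadic, eval_app,
    eval_wk, eval_here, eval_add, eval_one]

@[simp] theorem sat_rEq : Sat ν ρ (rEq x y) ↔ REq (eval ν ρ x) (eval ν ρ y) := by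
  simp only [rEq, REq, sat_allQ, sat_qLe, eval_qAbs, eval_qSub, eval_qDyadic, eval_app,
    eval_wk, eval_here, eval_two]

@[simp] theorem sat_rLe : Sat ν ρ (rLe x y) ↔ RLe (eval ν ρ x) (eval ν ρ y) := by
  simp only [rLe, RLe, sat_allQ, sat_qLe, eval_qAdd, eval_qDyadic, eval_app,
    eval_wk, eval_here, eval_two]

@[simp] theorem eval_ofQ : eval ν ρ (ofQ q) = lam fun _ => eval ν ρ q := by
  simp [ofQ]

@[simp] theorem sat_inUnit : Sat ν ρ (inUnit x) ↔ InUnit (eval ν ρ x) := by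
  simp only [inUnit, sat_and, sat_isReal, sat_rLe, rZero, rOne, eval_ofQ, InUnit, RLe, lam_ap,
    eval_mkQ, eval_zero, eval_one, zero_eq]

@[simp] theorem sat_distLt :
    Sat ν ρ (distLt x y z) ↔ DistLt (eval ν ρ x) (eval ν ρ y) (eval ν ρ z) := by
  simp only [distLt, DistLt, rLt, sat_neg, sat_rLe, RLe, rAbs, rSub, eval_lamQ, eval_qAbs,
    eval_qSub, eval_app, eval_wk, eval_here, eval_sc, lam_ap, not_forall]

@[simp] theorem sat_near :
    Sat ν ρ (near x y p) ↔ Near (eval ν ρ x) (eval ν ρ y) (eval ν ρ p) := by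
  simp only [near, Near, sat_distLt, DistLt, eval_ofQ, eval_qDyadic, eval_one, lam_ap]

end Sat

/-! ### Estimates for fast-converging sequences -/

section Lemmas

variable {x y z : M.C T1} {k : M.C T0}

theorem of_two : of (2 : M.C T0) = 2 := map_ofNat _ 2

theorem isReal_iff : IsReal x ↔ ∀ k i, |qv (x ⊙ k) - qv (x ⊙ (k + i))| ≤ eps k := by
  simp [IsReal]

theorem rEq_iff : REq x y ↔ ∀ k, |qv (x ⊙ k) - qv (y ⊙ k)| ≤ 2 * eps k := by
  simp [REq, of_two]

theorem near_iff : Near x y k ↔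
    ∃ j, |qv (x ⊙ (j + 1)) - qv (y ⊙ (j + 1))| + 2 * eps j < eps k := by
  simp [Near, of_two]

theorem distLt_iff {r : M.C T1} : DistLt x y r ↔
    ∃ j, |qv (x ⊙ (j + 1)) - qv (y ⊙ (j + 1))| + 2 * eps j < qv (r ⊙ j) := by
  simp [DistLt, of_two]

theorem inUnit_iff : InUnit x ↔
    IsReal x ∧ (∀ k, 0 ≤ qv (x ⊙ k) + 2 * eps k) ∧ ∀ k, qv (x ⊙ k) ≤ 1 + 2 * eps k := by
  have h0 : qv (nQ (0 : M.C T0) 0 0) = 0 := by simp [qv_nQ]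
  have h1 : qv (nQ (1 : M.C T0) 0 0) = 1 := by simp [qv_nQ]
  simp [InUnit, h0, h1, of_two]

theorem IsReal.abs_sub_le (hx : IsReal x) (j k : M.C T0) :
    |qv (x ⊙ j) - qv (x ⊙ k)| ≤ eps j + eps k := by
  rw [isReal_iff] at hx
  rcases le_total j k with h | h
  · obtain ⟨i, rfl⟩ := exists_add_of_le h
    linarith [hx j i, eps_pos (j + i)]
  · obtain ⟨i, rfl⟩ := exists_add_of_le h
    rw [abs_sub_comm]
    linarith [hx k i, eps_pos (k + i)]

theorem REq.refl (x : M.C T1) : REq x x := rEq_iff.2 fun k => by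
  simpa using (eps_pos k).le

theorem REq.symm (h : REq x y) : REq y x := rEq_iff.2 fun k => by
  rw [abs_sub_comm]
  exact rEq_iff.1 h k

/-- Any constant multiple of 2^{-k} suffices: compare at a far index j. The errors add up to
2·2^{-k} + (c + 2)·2^{-j}, and j is arbitrary. -/
theorem rEq_of_forall (hx : IsReal x) (hy : IsReal y) {c : Frac (M.C T0)} (hc : 0 < c)
    (h : ∀ k, |qv (x ⊙ k) - qv (y ⊙ k)| ≤ c * eps k) : REq x y := by
  refine rEq_iff.2 fun k => le_of_forall_eps (c := c + 2) (by linarith) fun j => ?_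
  have h1 := hx.abs_sub_le k j
  have h2 := hy.abs_sub_le j k
  have h3 := h j
  have h4 : |qv (x ⊙ k) - qv (y ⊙ k)| ≤ |qv (x ⊙ k) - qv (x ⊙ j)| +
      |qv (x ⊙ j) - qv (y ⊙ j)| + |qv (y ⊙ j) - qv (y ⊙ k)| := by
    rw [show qv (x ⊙ k) - qv (y ⊙ k) = (qv (x ⊙ k) - qv (x ⊙ j)) +
      (qv (x ⊙ j) - qv (y ⊙ j)) + (qv (y ⊙ j) - qv (y ⊙ k)) by ring]
    exact abs_add_three _ _ _
  linarith

theorem REq.trans (hx : IsReal x) (hz : IsReal z) (h : REq x y) (h' : REq y z) : REq x z := by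
  refine rEq_of_forall hx hz (c := 4) (by norm_num) fun k => ?_
  have := abs_sub_le (qv (x ⊙ k)) (qv (y ⊙ k)) (qv (z ⊙ k))
  linarith [rEq_iff.1 h k, rEq_iff.1 h' k]

theorem Near.mono {i : M.C T0} (h : Near x y k) (hi : i ≤ k) : Near x y i := by
  rw [near_iff] at h ⊢
  obtain ⟨j, h⟩ := h
  exact ⟨j, h.trans_le (eps_anti hi)⟩

theorem Near.congr_right (hx : IsReal x) (hy : IsReal y) (h : Near x y k) (hyz : REq y z) :
    Near x z k := by
  rw [near_iff] at h ⊢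
  obtain ⟨j, h⟩ := h
  -- Changing index and representative costs at most 3/2 · 2^{-j}, and the new margin is 2 ·
  -- 2^{-j-3}. Together they stay below the old margin 2 · 2^{-j}.
  refine ⟨j + 1 + 1 + 1, ?_⟩
  have h1 := abs_le.1 (hx.abs_sub_le (j + 1) (j + 1 + 1 + 1 + 1))
  have h2 := abs_le.1 (hy.abs_sub_le (j + 1) (j + 1 + 1 + 1 + 1))
  have h3 := abs_le.1 (rEq_iff.1 hyz (j + 1 + 1 + 1 + 1))
  simp only [eps_add_one] at *
  have h4 := abs_le.1 (le_refl |qv (x ⊙ (j + 1)) - qv (y ⊙ (j + 1))|)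
  have : |qv (x ⊙ (j + 1 + 1 + 1 + 1)) - qv (z ⊙ (j + 1 + 1 + 1 + 1))| ≤
      |qv (x ⊙ (j + 1)) - qv (y ⊙ (j + 1))| + 3 / 2 * eps j := by
    rw [abs_le]
    constructor <;> linarith [eps_pos j]
  linarith [eps_pos j]

theorem exists_not_near (hx : IsReal x) (hy : IsReal y) (h : ¬ REq x y) : ∃ k, ¬ Near x y k := by
  simp only [rEq_iff, not_forall, not_le] at h
  obtain ⟨k, hk⟩ := h
  obtain ⟨i, hi⟩ := exists_eps_lt (sub_pos.2 hk)
  refine ⟨i, fun h => ?_⟩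
  obtain ⟨j, hj⟩ := near_iff.1 h
  have h1 := hx.abs_sub_le k (j + 1)
  have h2 := hy.abs_sub_le (j + 1) k
  have h4 : |qv (x ⊙ k) - qv (y ⊙ k)| ≤ |qv (x ⊙ k) - qv (x ⊙ (j + 1))| +
      |qv (x ⊙ (j + 1)) - qv (y ⊙ (j + 1))| + |qv (y ⊙ (j + 1)) - qv (y ⊙ k)| := by
    rw [show qv (x ⊙ k) - qv (y ⊙ k) = (qv (x ⊙ k) - qv (x ⊙ (j + 1))) +
      (qv (x ⊙ (j + 1)) - qv (y ⊙ (j + 1))) + (qv (y ⊙ (j + 1)) - qv (y ⊙ k)) by ring]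
    exact abs_add_three _ _ _
  rw [eps_add_one] at h1 h2
  linarith [eps_pos j]

end Lemmas

end Model

end HORM

namespace HORM

namespace Model

variable {M : Model} [HasE2 M]

open Frac (of)

/-! ## Avoiding finitely many shrinking intervals -/

section Avoid

variable (Y : M.C T2) (k : M.C T0) (y : M.C (T0 ⇒ T1))

/-- Some `y i` with `Y (y i) = m` is at most the midpoint of `[u / 4^m, (u + 1) / 4^m]`. -/
def LeftHalf (u m : M.C T0) : Prop :=
  ∃ i, i ≤ k ∧ Y ⊙ (y ⊙ i) = m ∧
    ∀ j, qv (y ⊙ i ⊙ j) ≤ qv (nQAdd (nDyadic (2 * u + 1) (2 * m + 1)) (nDyadic 1 j))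

open Classical in
/-- The left end points, multiplied by `4^m`, of a nested sequence of intervals. -/
noncomputable def avoidSeq (m : M.C T0) : M.C T0 :=
  natrec m 0 fun u v => 4 * u + if LeftHalf Y k y u v then 3 else 0

/-- The real number in the nested intervals. -/
noncomputable def avoid : M.C T1 := lam fun m => nDyadic (avoidSeq Y k y m) (2 * m)

instance : IsDefP fun p : (M.Pt × M.C T0) × M.C T0 => LeftHalf Y k y p.1.2 p.2 := by
  unfold LeftHalf
  infer_instance

instance : IsDefP fun p : ((M.Pt × M.C T0) × M.C T0) × M.C T0 => LeftHalf Y k y p.1.2 p.2 := by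
  unfold LeftHalf
  infer_instance

instance : IsDef fun p : M.Pt × M.C T0 => avoidSeq Y k y p.2 := by
  unfold avoidSeq
  infer_instance

theorem qv_avoid (m : M.C T0) : qv (avoid Y k y ⊙ m) = of (avoidSeq Y k y m) * eps (2 * m) := by
  rw [avoid, lam_ap, qv_nDyadic]

omit [HasE2 M] in
theorem eps_two_mul_add_one (m : M.C T0) : eps (2 * (m + 1)) = eps (2 * m) / 4 := by
  rw [show 2 * (m + 1) = 2 * m + 1 + 1 by ring, eps_add_one, eps_add_one]
  ring

-- Passing to scale 4^{-m-1} leaves the left end point in place (first quarter) or moves it by three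
-- quarters of the current length (last quarter).
open Classical in
theorem qv_avoid_add_one (m : M.C T0) : qv (avoid Y k y ⊙ (m + 1)) = qv (avoid Y k y ⊙ m) +
    (if LeftHalf Y k y (avoidSeq Y k y m) m then 3 / 4 else 0) * eps (2 * m) := by
  have : avoidSeq Y k y (m + 1) = 4 * avoidSeq Y k y m +
      if LeftHalf Y k y (avoidSeq Y k y m) m then 3 else 0 := natrec_add_one m
  have h4 : of (4 : M.C T0) = 4 := map_ofNat _ 4
  have h3 : of (3 : M.C T0) = 3 := map_ofNat _ 3
  rw [qv_avoid, qv_avoid, this, eps_two_mul_add_one, map_add, map_mul, h4]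
  split_ifs
  · rw [h3]; ring
  · rw [map_zero]; ring

theorem avoid_nested (m i : M.C T0) : qv (avoid Y k y ⊙ m) ≤ qv (avoid Y k y ⊙ (m + i)) ∧
    qv (avoid Y k y ⊙ (m + i)) + eps (2 * (m + i)) ≤ qv (avoid Y k y ⊙ m) + eps (2 * m) := by
  -- The right end points are written as codes to make the induction predicate definable.
  have key : qv (avoid Y k y ⊙ m) ≤ qv (avoid Y k y ⊙ (m + i)) ∧
      qv (nQAdd (avoid Y k y ⊙ (m + i)) (nDyadic 1 (2 * (m + i)))) ≤
        qv (nQAdd (avoid Y k y ⊙ m) (nDyadic 1 (2 * m))) := by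
    induction i using induction_on' with
    | h => infer_instance
    | h0 => simp
    | hs i ih =>
      simp only [qv_nQAdd, qv_nDyadic, map_one, one_mul] at ih ⊢
      rw [← add_assoc, qv_avoid_add_one, eps_two_mul_add_one]
      have := eps_pos (2 * (m + i))
      split_ifs <;> constructor <;> linarith [ih.1, ih.2]
  simpa only [qv_nQAdd, qv_nDyadic, map_one, one_mul] using key

omit [HasE2 M] in
theorem eps_two_mul_le (k : M.C T0) : eps (2 * k) ≤ eps k := by
  rw [two_mul]
  exact eps_anti le_self_add

theorem inUnit_avoid : InUnit (avoid Y k y) := by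
  have h0 : qv (avoid Y k y ⊙ 0) = 0 := by
    rw [qv_avoid, avoidSeq, natrec_zero, map_zero, zero_mul]
  refine inUnit_iff.2 ⟨isReal_iff.2 fun m i => ?_, fun m => ?_, fun m => ?_⟩
  · have h := avoid_nested Y k y m i
    rw [abs_le]
    constructor <;> linarith [eps_pos (2 * (m + i)), eps_two_mul_le m, eps_pos m, h.1, h.2]
  · have h := avoid_nested Y k y 0 m
    rw [h0, zero_add] at h
    linarith [h.1, eps_pos m]
  · have h := avoid_nested Y k y 0 m
    rw [h0, zero_add, mul_zero, eps_zero] at h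
    linarith [h.2, eps_pos m, eps_pos (2 * m)]

variable {Y k y}

/-- Let m = Y(y_i). Stage m puts the constructed point in the quarter at the far end from the half
containing y_i, so a quarter of 4^{-m} separates them; the rest of the proof controls approximation
errors. -/
theorem not_distLt_avoid (hy : ∀ i, i ≤ k → InUnit (y ⊙ i))
    (hinj : ∀ x x', InUnit x → InUnit x' → Y ⊙ x = Y ⊙ x' → REq x x')
    {i : M.C T0} (hi : i ≤ k) {r : M.C T1} (hr : ∀ j, qv (r ⊙ j) = eps (2 * (Y ⊙ (y ⊙ i)) + 2)) :
    ¬ DistLt (avoid Y k y) (y ⊙ i) r := by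
  rw [distLt_iff]
  rintro ⟨j, hj⟩
  rw [hr] at hj
  set m := Y ⊙ (y ⊙ i) with hm
  have he : eps (2 * m + 2) = eps (2 * m) / 4 := by
    rw [← eps_two_mul_add_one, mul_add, mul_one]
  have hmid : of (2 * avoidSeq Y k y m + 1) * eps (2 * m + 1) =
      qv (avoid Y k y ⊙ m) + eps (2 * m) / 2 := by
    rw [qv_avoid, eps_add_one, map_add, map_mul, of_two, map_one]
    ring
  -- For j ≤ m the margin 2 · 2^{-j} alone exceeds the radius 4^{-m-1}; so the comparison takes
  -- place after stage m has been decided.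
  have hmj : m < j := by
    by_contra! h
    have : eps (2 * m + 2) ≤ eps j :=
      eps_anti (h.trans (by rw [two_mul, add_assoc]; exact le_self_add))
    linarith [abs_nonneg (qv (avoid Y k y ⊙ (j + 1)) - qv (y ⊙ i ⊙ (j + 1))), eps_pos j]
  obtain ⟨d, hd⟩ := exists_add_of_le (add_le_add_left hmj.le 1)
  have hn := avoid_nested Y k y (m + 1) d
  rw [← hd, qv_avoid_add_one, eps_two_mul_add_one m] at hn
  have hej := eps_add_one j
  have hpos := eps_pos (2 * (j + 1))
  have hposj := eps_pos j
  by_cases hB : LeftHalf Y k y (avoidSeq Y k y m) m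
  · rw [if_pos hB] at hn
    obtain ⟨i', hi', hYi', hB⟩ := hB
    have h1 := hB (j + 1)
    rw [qv_nQAdd, qv_nDyadic, qv_nDyadic, hmid, map_one, one_mul] at h1
    -- The index i' that triggered the choice may differ from i, but injectivity makes the two
    -- points equal reals.
    have h2 := abs_le.1 (rEq_iff.1 (hinj _ _ (hy i hi) (hy i' hi') (hm ▸ hYi'.symm)) (j + 1))
    have h3 := le_abs_self (qv (avoid Y k y ⊙ (j + 1)) - qv (y ⊙ i ⊙ (j + 1)))
    linarith [hn.1, h2.2]
  · rw [if_neg hB] at hn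
    have : ∃ j', ¬ qv (y ⊙ i ⊙ j') ≤
        qv (nQAdd (nDyadic (2 * avoidSeq Y k y m + 1) (2 * m + 1)) (nDyadic 1 j')) := by
      by_contra! h
      exact hB ⟨i, hi, rfl, h⟩
    obtain ⟨j', hj'⟩ := this
    rw [qv_nQAdd, qv_nDyadic, qv_nDyadic, hmid, map_one, one_mul, not_le] at hj'
    have h2 := abs_le.1 ((hy i hi).1.abs_sub_le j' (j + 1))
    have h3 := neg_abs_le (qv (avoid Y k y ⊙ (j + 1)) - qv (y ⊙ i ⊙ (j + 1)))
    linarith [hn.2, h2.2]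

end Avoid

/-! ## Coding real numbers by elements of Cantor space -/

section Coding

/-- The rational number `q` approximates the real number `x` up to `2^{-k-2}`. -/
def Approx (x : M.C T1) (q k : M.C T0) : Prop :=
  ∀ j, qv (nQAbs (nQSub (x ⊙ j) q)) ≤ qv (nQAdd (nDyadic 1 (k + 2)) (nDyadic 1 j))

open Classical in
/-- The set of all pairs of a rational number and a precision to which it approximates `x`. -/
noncomputable def encode (x : M.C T1) : M.C T1 :=
  lam fun p => if Approx x (nFst p) (nSnd p) then 0 else 1

/-- The real number with a given set of approximations; `F` finds zeros. -/
noncomputable def decode (F : M.C T2) (f : M.C T1) : M.C T1 :=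
  lam fun k => F ⊙ lam fun v => f ⊙ nPair v k

instance {X : Type} [Ctx M X] {f : X → M.C T1} [hf : IsDef f] : IsDef fun x => encode (f x) := by
  have := (hf.fst (σ := T0)).fst (σ := T0)
  have := hf.fst (σ := T0)
  unfold encode Approx
  infer_instance

omit [HasE2 M] in
instance {X : Type} [Ctx M X] {F : M.C T2} {f : X → M.C T1} [hf : IsDef f] :
    IsDef fun x => decode F (f x) := by
  have := (hf.fst (σ := T0)).fst (σ := T0)
  unfold decode
  infer_instance

variable {x x' : M.C T1} {F : M.C T2}

omit [HasE2 M] in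
theorem approx_iff {q k : M.C T0} :
    Approx x q k ↔ ∀ j, |qv (x ⊙ j) - qv q| ≤ eps (k + 2) + eps j := by
  simp [Approx]

open Classical in
theorem encode_ap (p : M.C T0) :
    encode x ⊙ p = if Approx x (nFst p) (nSnd p) then 0 else 1 := by
  have : IsDefP fun p : M.Pt × M.C T0 => Approx x (nFst p.2) (nSnd p.2) := by
    unfold Approx
    infer_instance
  rw [encode, lam_ap]

theorem encode_le_one (p : M.C T0) : encode x ⊙ p ≤ 1 := by
  rw [encode_ap]
  split_ifs
  exacts [zero_le, le_rfl]

-- The non-strict bound with an error term at every index is what makes approximation independent of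
-- the representative: the extra error 4 · 2^{-i} disappears as i varies.
omit [HasE2 M] in
theorem Approx.congr (hx' : IsReal x') (h : REq x x') {q k : M.C T0} (ha : Approx x q k) :
    Approx x' q k := by
  rw [approx_iff] at ha ⊢
  refine fun j => le_of_forall_eps (c := 4) (by norm_num) fun i => ?_
  have h1 := abs_le.1 (hx'.abs_sub_le j i)
  have h2 := abs_le.1 (rEq_iff.1 h i)
  have h3 := abs_le.1 (ha i)
  rw [abs_le]
  constructor <;> linarith [h1.1, h1.2, h2.1, h2.2, h3.1, h3.2]

/-- Equal reals have identical codes; this is what turns injectivity up to equality of reals into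
the uniqueness hypothesis of `IND₀`. -/
theorem encode_congr (hx : IsReal x) (hx' : IsReal x') (h : REq x x') : encode x = encode x' := by
  refine ap_ext fun p => ?_
  rw [encode_ap, encode_ap]
  congr 1
  exact propext ⟨.congr hx' h, .congr hx h.symm⟩

variable (hF : ∀ f : M.C T1, (∃ n, f ⊙ n = 0) → f ⊙ (F ⊙ f) = 0)

include hF

theorem approx_decode_encode (hx : IsReal x) (k : M.C T0) :
    Approx x (decode F (encode x) ⊙ k) k := by
  -- The search succeeds because x(k+2) itself is an approximation of precision 2^{-k-2}.
  have h := hF (lam fun v => encode x ⊙ nPair v k) ⟨x ⊙ (k + 2), by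
    rw [lam_ap, encode_ap, nFst_nPair, nSnd_nPair, if_pos]
    exact approx_iff.2 fun j => (hx.abs_sub_le j (k + 2)).trans_eq (add_comm _ _)⟩
  rw [lam_ap, encode_ap, nFst_nPair, nSnd_nPair] at h
  rw [decode, lam_ap]
  by_contra hc
  rw [if_neg hc] at h
  exact one_ne_zero h

omit [HasE2 M] hF in
theorem eps_add_two (k : M.C T0) : eps (k + 2) = eps k / 4 := by
  rw [← one_add_one_eq_two, ← add_assoc, eps_add_one, eps_add_one]
  ring

theorem isReal_decode_encode (hx : IsReal x) : IsReal (decode F (encode x)) := by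
  refine isReal_iff.2 fun k i => ?_
  have h1 := abs_le.1 (approx_iff.1 (approx_decode_encode hF hx k) (k + 2))
  have h2 := abs_le.1 (approx_iff.1 (approx_decode_encode hF hx (k + i)) (k + 2))
  have h3 : eps (k + i) ≤ eps k := eps_anti le_self_add
  rw [eps_add_two] at h1 h2
  rw [eps_add_two] at h2
  rw [abs_le]
  constructor <;> linarith [h1.1, h1.2, h2.1, h2.2]

theorem rEq_decode_encode (hx : IsReal x) : REq x (decode F (encode x)) := by
  refine rEq_iff.2 fun k => ?_
  have h1 := approx_iff.1 (approx_decode_encode hF hx k) k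
  rw [eps_add_two] at h1
  linarith [eps_pos k]

theorem inUnit_decode_encode (hx : InUnit x) : InUnit (decode F (encode x)) := by
  obtain ⟨hr, h0, h1⟩ := inUnit_iff.1 hx
  refine inUnit_iff.2 ⟨isReal_decode_encode hF hr, fun k => ?_, fun k => ?_⟩
  all_goals
    have h2 := abs_le.1 (approx_iff.1 (approx_decode_encode hF hr k) (k + 2))
    have h3 := h0 (k + 2)
    have h4 := h1 (k + 2)
    rw [eps_add_two] at h2 h3 h4
    linarith [h2.1, h2.2, eps_pos k]

end Coding

/-! ## Listing the points with small values -/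

/-- The principle `IND₀` in a model. -/
def HasInd (M : Model) : Prop :=
  ∀ Y : M.C (T1 ⇒ T0 ⇒ T0),
    (∀ n f g, (∀ i, f ⊙ i ≤ 1) → (∀ i, g ⊙ i ≤ 1) → Y ⊙ f ⊙ n = 0 → Y ⊙ g ⊙ n = 0 → f = g) →
    ∀ k, ∃ l, ∃ w : M.C (T0 ⇒ T1), ∀ m, m ≤ k →
      ((∃ i, i < l ∧ (∀ j, w ⊙ i ⊙ j ≤ 1) ∧ Y ⊙ (w ⊙ i) ⊙ m = 0) ↔
        ∃ f, (∀ j, f ⊙ j ≤ 1) ∧ Y ⊙ f ⊙ m = 0)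

section Listing

variable {Y : M.C T2}

/-- Apply `IND₀` to the functional vanishing at (f, m) exactly when f is the code of a point of
[0,1] with value m. Decoding the resulting sequence lists the points with value at most n. -/
theorem exists_list (hM : HasInd M)
    (hY : ∀ x x', InUnit x → InUnit x' → REq x x' → Y ⊙ x = Y ⊙ x')
    (hinj : ∀ x x', InUnit x → InUnit x' → Y ⊙ x = Y ⊙ x' → REq x x') (n : M.C T0) :
    ∃ l, ∃ z : M.C (T0 ⇒ T1), ∀ x, InUnit x → Y ⊙ x ≤ n →
      ∃ i, i < l ∧ InUnit (z ⊙ i) ∧ REq (z ⊙ i) x := by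
  classical
  obtain ⟨F, hF⟩ := exists_search (M := M)
  let Z : M.C (T1 ⇒ T0 ⇒ T0) := lam fun f => lam fun m =>
    if InUnit (decode F f) ∧ Y ⊙ decode F f = m ∧ ∀ i, f ⊙ i = encode (decode F f) ⊙ i then 0 else 1
  have hZ (f m) : Z ⊙ f ⊙ m = 0 ↔
      InUnit (decode F f) ∧ Y ⊙ decode F f = m ∧ f = encode (decode F f) := by
    simp only [Z, lam_ap]
    split_ifs with h
    · exact iff_of_true rfl ⟨h.1, h.2.1, ap_ext h.2.2⟩
    · exact iff_of_false one_ne_zero fun h' => h ⟨h'.1, h'.2.1, fun i => congrArg (· ⊙ i) h'.2.2⟩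
  obtain ⟨l, w, hw⟩ := hM Z (fun m f g _ _ hf hg => by
    rw [hZ] at hf hg
    rw [hf.2.2, hg.2.2]
    exact encode_congr hf.1.1 hg.1.1 (hinj _ _ hf.1 hg.1 (hf.2.1.trans hg.2.1.symm))) n
  refine ⟨l, lam fun i => decode F (w ⊙ i), fun x hx hxn => ?_⟩
  have hr := rEq_decode_encode hF hx.1
  have hu := inUnit_decode_encode hF hx
  -- Take m = Y(x): the code of x is a zero, so the sequence contains some zero for this m, and that
  -- zero decodes to x by injectivity.
  obtain ⟨i, hi, -, h⟩ := (hw _ hxn).2 ⟨encode x, encode_le_one,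
    (hZ _ _).2 ⟨hu, hY _ _ hu hx hr.symm, encode_congr hx.1 hu.1 hr⟩⟩
  rw [hZ] at h
  exact ⟨i, hi, by rw [lam_ap]; exact h.1, by rw [lam_ap]; exact hinj _ _ h.1 hx h.2.1⟩

/-- Induction on the length, which may be nonstandard; the statement is arithmetical in x and z, so
it is definable. Sums of precisions serve as upper bounds. -/
theorem exists_bound {x : M.C T1} (hx : IsReal x) (z : M.C (T0 ⇒ T1)) (l : M.C T0) :
    ∃ K, ∀ i, i < l → IsReal (z ⊙ i) → ¬ REq x (z ⊙ i) → ¬ Near x (z ⊙ i) K := by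
  induction l using induction_on' with
  | h => infer_instance
  | h0 => exact ⟨0, fun i hi => (not_lt.2 zero_le hi).elim⟩
  | hs l ih =>
    obtain ⟨K, hK⟩ := ih
    by_cases h : IsReal (z ⊙ l) ∧ ¬ REq x (z ⊙ l)
    · obtain ⟨K', hK'⟩ := exists_not_near hx h.1 h.2
      refine ⟨K + K', fun i hi hr he hn => ?_⟩
      rcases (lt_add_one_iff'.1 hi).lt_or_eq with hi | rfl
      · exact hK i hi hr he (hn.mono le_self_add)
      · exact hK' (hn.mono le_add_self)
    · refine ⟨K, fun i hi hr he => ?_⟩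
      rcases (lt_add_one_iff'.1 hi).lt_or_eq with hi | rfl
      · exact hK i hi hr he
      · exact (h ⟨hr, he⟩).elim

/-- In a set without isolated points, the points with small values can be avoided. -/
theorem exists_avoiding (hM : HasInd M)
    (hY : ∀ x x', InUnit x → InUnit x' → REq x x' → Y ⊙ x = Y ⊙ x')
    (hinj : ∀ x x', InUnit x → InUnit x' → Y ⊙ x = Y ⊙ x' → REq x x') (n : M.C T0)
    {P : M.C T1 → Prop} (hP : ∀ x, P x → InUnit x) (hne : ∃ x, P x)
    (hiso : ∀ x, P x → ∀ k, ∃ x', P x' ∧ ¬ REq x x' ∧ Near x x' k) :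
    ∃ x, P x ∧ n ≤ Y ⊙ x ∧ ∃ K, ∀ x', P x' → Near x x' K → n ≤ Y ⊙ x' := by
  obtain ⟨l, z, hz⟩ := exists_list hM hY hinj n
  obtain ⟨x₀, hx₀⟩ := hne
  obtain ⟨K₀, hK₀⟩ := exists_bound (hP _ hx₀).1 z l
  -- The starting point may itself be listed. A different member of P this close to it is neither
  -- the starting point nor any other listed point.
  obtain ⟨x, hx, hne, hnear⟩ := hiso x₀ hx₀ K₀
  have hxr := (hP _ hx).1
  have hxz (i) (hi : i < l) (hr : InUnit (z ⊙ i)) : ¬ REq x (z ⊙ i) := fun h =>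
    hK₀ i hi hr.1 (fun h' => hne (h'.trans (hP _ hx₀).1 hxr h.symm))
      (hnear.congr_right (hP _ hx₀).1 hxr h)
  obtain ⟨K, hK⟩ := exists_bound hxr z l
  refine ⟨x, hx, ?_, K, fun x' hx' hn => ?_⟩
  · by_contra! h
    obtain ⟨i, hi, hr, he⟩ := hz x (hP _ hx) h.le
    exact hxz i hi hr he.symm
  · by_contra! h
    obtain ⟨i, hi, hr, he⟩ := hz x' (hP _ hx') h.le
    exact hK i hi hr.1 (hxz i hi hr) (hn.congr_right hxr (hP _ hx').1 he.symm)

end Listing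

end Model

end HORM

namespace HORM

namespace Model

variable {M : Model}

open Frac (of)

/-! ### The gauge of an injection and the conclusion -/

theorem hasE2_of_sat {ν : M.Val} (h : Sat ν M.nilEnv existsTwo) : HasE2 M := by
  simp only [existsTwo, sat_exQ, sat_and, sat_allQ, sat_iff, sat_eq, eval_app, eval_wk, eval_here,
    eval_zero, zero_eq] at h
  obtain ⟨φ, -, h⟩ := h
  exact ⟨φ, h⟩

theorem hasInd_of_sat {ν : M.Val} (h : Sat ν M.nilEnv indZero) : HasInd M := by
  simp only [indZero, sat_exQ, sat_and, sat_allQ, sat_imp, sat_iff, sat_eq, sat_eqT, sat_leN,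
    sat_ltN, inCantor, eval_app, eval_wk, eval_here, eval_zero, eval_one, zero_eq] at h
  exact h

section

variable [HasE2 M] (Y : M.C T2)

/-- The gauge `x ↦ 4^{-Y(x)-1}`. -/
noncomputable def gauge : M.C (T1 ⇒ T1) :=
  lam fun x => lam fun _ => nDyadic 1 (2 * (Y ⊙ x) + 2)

open Classical in
/-- The gauge, with `Y` truncated at `n`. -/
noncomputable def truncGauge : M.C (T0 ⇒ T1 ⇒ T1) :=
  lam fun n => lam fun x => lam fun _ => nDyadic 1 (2 * (if Y ⊙ x ≤ n then Y ⊙ x else n) + 2)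

omit [HasE2 M] in
theorem gauge_ap (x : M.C T1) (k : M.C T0) :
    gauge Y ⊙ x ⊙ k = nDyadic 1 (2 * (Y ⊙ x) + 2) := by
  simp only [gauge, lam_ap]

omit [HasE2 M] in
theorem truncGauge_ap (n : M.C T0) (x : M.C T1) (k : M.C T0) :
    truncGauge Y ⊙ n ⊙ x ⊙ k = nDyadic 1 (2 * min (Y ⊙ x) n + 2) := by
  simp only [truncGauge, lam_ap, min_def]

omit [HasE2 M] in
theorem isReal_of_const {x : M.C T1} {q : M.C T0} (h : ∀ k, x ⊙ k = q) : IsReal x :=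
  isReal_iff.2 fun k i => by simpa [h] using (eps_pos k).le

omit [HasE2 M] in
theorem near_of_eq {x y : M.C T1} (h : ∀ k, x ⊙ k = y ⊙ k) (k : M.C T0) : Near x y k := by
  refine near_iff.2 ⟨k + 2, ?_⟩
  rw [h, sub_self, abs_zero, eps_add_two]
  linarith [eps_pos k]

variable {Y}

/-- The witnessing sequence is given by the truncations of Y. On a perfect set, `exists_avoiding`
supplies a point near which the n-th truncation is constant, hence continuous; only non-emptiness
and the absence of isolated points matter. -/
theorem sat_isB2_gauge (hM : HasInd M)
    (hY : ∀ x x', InUnit x → InUnit x' → REq x x' → Y ⊙ x = Y ⊙ x')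
    (hinj : ∀ x x', InUnit x → InUnit x' → Y ⊙ x = Y ⊙ x' → REq x x')
    {Γ : List FType} {ν : M.Val} {ρ : M.Env Γ} {g : Tm Γ (T1 ⇒ T1)} (hg : eval ν ρ g = gauge Y) :
    Sat ν ρ (isB2 g) := by
  simp only [isB2, isFunUnitReal, isLimit, isPerfectInUnit, continuousOnAt, mem, sat_exQ, sat_and,
    sat_allQ, sat_imp, sat_neg, sat_eq, sat_leN, sat_isReal, sat_rEq, sat_inUnit, sat_near,
    eval_app, eval_wk, eval_here, eval_one, hg]
  -- Convergence at x is eventual equality: truncating at any n ≥ Y(x) changes nothing, so Y(x) is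
  -- the modulus for every precision.
  refine ⟨⟨fun x _ => isReal_of_const (gauge_ap Y x), fun x x' hx hx' h => ?_⟩, truncGauge Y,
    fun n => ⟨fun x _ => isReal_of_const (truncGauge_ap Y n x), fun x x' hx hx' h => ?_⟩,
    fun x hx k => ⟨Y ⊙ x, fun n hn => near_of_eq (fun j => ?_) k⟩, fun n P hP => ?_⟩
  · have : gauge Y ⊙ x = gauge Y ⊙ x' := ap_ext fun k => by
      rw [gauge_ap, gauge_ap, hY x x' hx hx' h]
    exact this ▸ REq.refl _
  · have : truncGauge Y ⊙ n ⊙ x = truncGauge Y ⊙ n ⊙ x' := ap_ext fun k => by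
      rw [truncGauge_ap, truncGauge_ap, hY x x' hx hx' h]
    exact this ▸ REq.refl _
  · rw [truncGauge_ap, gauge_ap, min_eq_left hn]
  · obtain ⟨-, hu, hne, -, hiso⟩ := hP
    obtain ⟨x, hx, hxn, K, hK⟩ := exists_avoiding hM hY hinj n
      (P := fun x => IsReal x ∧ P ⊙ x = 1) hu hne hiso
    refine ⟨x, hx, fun k => ⟨K, fun y hy hxy => near_of_eq (fun j => ?_) k⟩⟩
    rw [truncGauge_ap, truncGauge_ap, min_eq_right hxn, min_eq_right (hK y hy hxy)]

theorem sat_HBUB2_imp_NIN (hM : HasInd M) (ν : M.Val) : Sat ν M.nilEnv (HBUB2 ⟶ NIN) := by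
  intro h
  simp only [NIN, isFunUnitNat, sat_neg, sat_exQ, sat_and, sat_allQ, sat_imp, sat_eq, sat_rEq,
    sat_inUnit, eval_app, eval_wk, eval_here]
  rintro ⟨Y, hY, hinj⟩
  simp only [HBUB2, sat_exQ, sat_and, sat_allQ, sat_imp, sat_leN, sat_inUnit, sat_distLt, rLt,
    sat_neg, sat_rLe, rZero, eval_ofQ, eval_mkQ, eval_zero, eval_app, eval_wk, eval_here] at h
  obtain ⟨k, y, hy, hcov⟩ := h (gauge Y) (sat_isB2_gauge hM hY hinj rfl) fun x _ hle => by
    have h0 : qv (nQ (0 : M.C T0) 0 0) = 0 := by simp [qv_nQ]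
    -- Positivity shows two places beyond the exponent of the radius, where the allowed error is
    -- only half the radius.
    have := hle (2 * (Y ⊙ x) + 2 + 2)
    rw [lam_ap, gauge_ap, qv_nQAdd, qv_nDyadic, qv_nDyadic, zero_eq, h0, of_two, map_one,
      eps_add_two (2 * (Y ⊙ x) + 2)] at this
    linarith [eps_pos (2 * (Y ⊙ x) + 2)]
  obtain ⟨i, hi, hd⟩ := hcov _ (inUnit_avoid Y k y)
  refine not_distLt_avoid hy hinj hi (fun j => ?_) hd
  rw [gauge_ap, qv_nDyadic, map_one, one_mul]

end

end Model

end HORM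

/-- The system `ACA₀^ω + IND₀` proves that `HBU` restricted to `B2` implies `NIN`. -/
theorem mainTheorem8 :
    HORM.Proves HORM.ACA0omegaIND0 [] (HORM.Fm.imp HORM.HBUB2 HORM.NIN) := by
  refine HORM.proves_of_sat (fun φ h => .inl h) fun M ν hM => ?_
  have := HORM.Model.hasE2_of_sat (hM _ (.inr (.inl rfl)))
  exact HORM.Model.sat_HBUB2_imp_NIN (HORM.Model.hasInd_of_sat (hM _ (.inr (.inr rfl)))) ν
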